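/- Let $d,p\in\mathbb N$, $\mu\in\mathbb R$, $T\ge 0$, let $\mathbb T^d=(\mathbb R/2\pi\mathbb Z)^d$, let $\hat f_k$ ($k\in\mathbb Z^d$) be the Fourier coefficients of $f$, so that $f(x)=\sum_k \hat f_k e^{ik\cdot x}$, and let $\|f\|_s=\big(\sum_{k}(1+|k|)^{2s}|\hat f_k|^2\big)^{1/2}$ be the norm of $H^s=H^s(\mathbb T^d)$. Operators $F(z\Delta)$ multiply $\hat f_k$ by $F(-z|k|^2)$, and $\varphi_1(z)=(e^z-1)/z$, $\varphi_1(0)=1$. Let $r>d/2$, $0<\gamma\le 1$ and $M\ge 0$. Then there are constants $\tau_0>0$ and $c>0$, depending only on $d,p,\mu,r,\gamma,T$ and $M$, with the following property. Let $v$ solve $$ i\,\partial_t v(t)=\mu\, e^{-it\Delta}\Big[\,|e^{it\Delta}v(t)|^{2p}\,e^{it\Delta}v(t)\Big]\qquad (0\le t\le T)$$ in $H^r$ (the equation satisfied by the twisted variable $v(t)=e^{-it\Delta}u(t)$ of the nonlinear Schrödinger equation $i\partial_t u=-\Delta u+\mu|u|^{2p}u$ on $\mathbb T^d$), and suppose that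 $v(t)\in H^{r+\gamma}$ for $0\le t\le T$ with $\sup_{0\le t\le T}\|v(t)\|_{r+\gamma}\le M$. For a step size $\tau>0$ put $t_n=n\tau$, $v^0=v(0)$ and $$ v^{n+1}=v^n-i\mu\tau\, e^{-it_n\Delta}\Big[\big(e^{it_n\Delta}v^n\big)^{p+1}\Big(\varphi_1(-2i\tau\Delta)\big(e^{-it_n\Delta}\overline{v^n}\big)^{p}\Big)\Big].$$ Then for all $0<\tau\le\tau_0$ and all $n\ge 0$ with $t_n\le T$ one has $v^n\in H^r$ and $$\|v(t_n)-v^n\|_r\le c\,\tau^\gamma .$$ -/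

import Mathlib

open MeasureTheory Filter Topology Set
open scoped Real NNReal ENNReal ComplexConjugate

noncomputable section

namespace TwistedNLS

instance fact_two_pi_pos : Fact (0 < 2 * π) := ⟨Real.two_pi_pos⟩

/-- The torus `𝕋^d = (ℝ/2πℤ)^d`. -/
abbrev Torus (d : ℕ) : Type := Fin d → AddCircle (2 * π)

/-- Normalized Haar (Lebesgue) measure `(2π)^{-d} dx` on `𝕋^d`. -/
def haar (d : ℕ) : Measure (Torus d) :=
  Measure.pi fun _ => (AddCircle.haarAddCircle : Measure (AddCircle (2 * π)))

variable {d : ℕ}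

/-- The character `x ↦ e^{i k·x}`. -/
def character (k : Fin d → ℤ) (x : Torus d) : ℂ := ∏ j, fourier (k j) (x j)

/-- The Fourier coefficient `f̂_k = (2π)^{-d} ∫ f(x) e^{-i k·x} dx`. -/
def coeff (f : Torus d → ℂ) (k : Fin d → ℤ) : ℂ :=
  ∫ x, conj (character k x) * f x ∂(haar d)

/-- `|k|² = k_1² + … + k_d²`. -/
def freqSq (k : Fin d → ℤ) : ℝ := ∑ j, (k j : ℝ) ^ 2

/-- The Sobolev norm `‖f‖_s = (∑_k (1+|k|)^{2s} |f̂_k|²)^{1/2}`, with values in `[0, ∞]`. -/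
def eSobolevNorm (s : ℝ) (f : Torus d → ℂ) : ℝ≥0∞ :=
  (∑' k : Fin d → ℤ,
    ENNReal.ofReal ((1 + √(freqSq k)) ^ (2 * s) * ‖coeff f k‖ ^ 2)) ^ (1 / 2 : ℝ)

/-- `f ∈ H^s(𝕋^d)`, for `s ≥ 0`: a square integrable function of finite Sobolev norm. -/
def MemSobolev (s : ℝ) (f : Torus d → ℂ) : Prop :=
  MemLp f 2 (haar d) ∧ eSobolevNorm s f < ∞

/-- The operator `F(zΔ)`: it multiplies the `k`-th Fourier coefficient by `F(-z|k|²)`. The series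
converges absolutely and uniformly when the Fourier coefficients of `f` are absolutely summable
(as they are for `f ∈ H^r`, `r > d/2`) and `F` is bounded on the values `-z|k|²`. -/
def funLaplacian (F : ℂ → ℂ) (z : ℂ) (f : Torus d → ℂ) : Torus d → ℂ := fun x =>
  ∑' k : Fin d → ℤ, F (z * ((-freqSq k : ℝ) : ℂ)) * coeff f k * character k x

/-- The Schrödinger group `e^{itΔ}`. -/
def schrodinger (t : ℝ) (f : Torus d → ℂ) : Torus d → ℂ :=
  funLaplacian Complex.exp (Complex.I * t) f

/-- `φ₁(z) = (e^z - 1)/z`, extended by continuity to `φ₁(0) = 1`. -/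
def phi1 (z : ℂ) : ℂ := if z = 0 then 1 else (Complex.exp z - 1) / z

/-- The twisted nonlinearity `e^{-itΔ} [ |e^{itΔ} w|^{2p} e^{itΔ} w ]`. -/
def twistedNonlinearity (p : ℕ) (t : ℝ) (w : Torus d → ℂ) : Torus d → ℂ :=
  schrodinger (-t) fun x => ((‖schrodinger t w x‖ ^ (2 * p) : ℝ) : ℂ) * schrodinger t w x

/-- The curve `v` has the derivative `w` at `t` in `H^s`, relative to the time set `S`. -/
def HasSobolevDerivWithinAt (s : ℝ) (v : ℝ → Torus d → ℂ) (w : Torus d → ℂ) (S : Set ℝ) (t : ℝ) :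
    Prop :=
  Tendsto (fun t' : ℝ => eSobolevNorm s fun x => ((t' - t : ℝ) : ℂ)⁻¹ * (v t' x - v t x) - w x)
    (𝓝[S \ {t}] t) (𝓝 0)

/-- `v` solves `i ∂_t v = μ e^{-itΔ} [ |e^{itΔ} v|^{2p} e^{itΔ} v ]` in `H^r` on `[0, T]`. -/
structure IsSolution (p : ℕ) (μ r T : ℝ) (v : ℝ → Torus d → ℂ) : Prop where
  mem : ∀ t ∈ Icc 0 T, MemSobolev r (v t)
  deriv : ∀ t ∈ Icc 0 T, HasSobolevDerivWithinAt r v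
    (fun x => -Complex.I * μ * twistedNonlinearity p t (v t) x) (Icc 0 T) t

/-- One step of the exponential-type integrator,
`w ↦ w - iμτ e^{-itΔ} [ (e^{itΔ} w)^{p+1} φ₁(-2iτΔ) (e^{-itΔ} w̄)^p ]`. -/
def step (p : ℕ) (μ τ t : ℝ) (w : Torus d → ℂ) : Torus d → ℂ := fun x =>
  w x - Complex.I * μ * τ * schrodinger (-t) (fun y =>
    schrodinger t w y ^ (p + 1) *
      funLaplacian phi1 (-2 * Complex.I * τ)
        (fun z => schrodinger (-t) (fun z' => conj (w z')) z ^ p) y) x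

/-- The numerical solution: `v^0 = v₀`, and `v^{n+1}` is obtained from `v^n` by one step of size `τ`
at the time `t_n = nτ`. -/
def scheme (p : ℕ) (μ τ : ℝ) (v₀ : Torus d → ℂ) : ℕ → Torus d → ℂ
  | 0 => v₀
  | n + 1 => step p μ τ (n * τ) (scheme p μ τ v₀ n)

end TwistedNLS

end

noncomputable section

namespace TwistedNLS

variable {d : ℕ}

/-- The weight `1 + |k|`. -/
def weight (k : Fin d → ℤ) : ℝ := 1 + √(freqSq k)

lemma one_le_weight (k : Fin d → ℤ) : 1 ≤ weight k := by
  unfold weight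
  linarith [Real.sqrt_nonneg (freqSq k)]

lemma weight_pos (k : Fin d → ℤ) : 0 < weight k := zero_lt_one.trans_le (one_le_weight k)

lemma freqSq_neg (k : Fin d → ℤ) : freqSq (-k) = freqSq k := by simp [freqSq]

lemma weight_neg (k : Fin d → ℤ) : weight (-k) = weight k := by simp [weight, freqSq_neg]

/-- A frequency as a vector of the Euclidean space. -/
def freqVec (k : Fin d → ℤ) : EuclideanSpace ℝ (Fin d) := WithLp.toLp 2 fun j => (k j : ℝ)

lemma freqSq_eq (k : Fin d → ℤ) : freqSq k = ‖freqVec k‖ ^ 2 := by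
  simp [freqSq, freqVec, EuclideanSpace.norm_sq_eq]

lemma weight_eq (k : Fin d → ℤ) : weight k = 1 + ‖freqVec k‖ := by
  rw [weight, freqSq_eq, Real.sqrt_sq (norm_nonneg _)]

lemma freqVec_add (k l : Fin d → ℤ) : freqVec (k + l) = freqVec k + freqVec l := by
  ext j; simp [freqVec]

lemma weight_add_le (k l : Fin d → ℤ) : weight (k + l) ≤ weight k + weight l := by
  simp only [weight_eq, freqVec_add]
  linarith [norm_add_le (freqVec k) (freqVec l)]

lemma abs_freqSq_add_sub_le (k l : Fin d → ℤ) :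
    |freqSq (k + l) - freqSq k - freqSq l| ≤ 2 * (weight k * weight l) := by
  have h : freqSq (k + l) - freqSq k - freqSq l = 2 * inner ℝ (freqVec k) (freqVec l) := by
    simp only [freqSq_eq, freqVec_add, norm_add_sq_real]; ring
  rw [h, abs_mul, abs_two]
  have := abs_real_inner_le_norm (freqVec k) (freqVec l)
  have h1 : ‖freqVec k‖ * ‖freqVec l‖ ≤ weight k * weight l := by
    rw [weight_eq, weight_eq]
    gcongr <;> linarith
  linarith

lemma weight_rpow_le {s : ℝ} (hs : 0 ≤ s) (k l : Fin d → ℤ) :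
    weight (k + l) ^ s ≤ 2 ^ s * (weight k ^ s + weight l ^ s) := by
  have hk := weight_pos k
  have hl := weight_pos l
  wlog h : weight l ≤ weight k generalizing k l
  · rw [add_comm, add_comm (weight k ^ s)]
    exact this l k hl hk (not_le.1 h).le
  calc weight (k + l) ^ s ≤ (2 * weight k) ^ s := by
        refine Real.rpow_le_rpow (weight_pos _).le ?_ hs
        linarith [weight_add_le k l]
    _ = 2 ^ s * weight k ^ s := Real.mul_rpow zero_le_two hk.le
    _ ≤ _ := by
        gcongr
        linarith [Real.rpow_nonneg hl.le s]

lemma summable_weight_rpow {r : ℝ} (hr : (d : ℝ) / 2 < r) :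
    Summable fun k : Fin d → ℤ => weight k ^ (-(2 * r)) := by
  let b := (EuclideanSpace.basisFun (Fin d) ℝ).toBasis
  let L := Submodule.span ℤ (Set.range b)
  have hfin : Module.finrank ℤ L = d := by
    rw [ZLattice.rank ℝ L]; simp
  have hmem (k : Fin d → ℤ) : freqVec k ∈ L := by
    have : freqVec k = ∑ j, k j • b j := by
      ext i
      simp [freqVec, b, Pi.single_apply]
    rw [this]
    exact Submodule.sum_mem _ fun j _ => Submodule.smul_mem _ _ (Submodule.subset_span ⟨j, rfl⟩)
  let e : (Fin d → ℤ) → L := fun k => ⟨freqVec k, hmem k⟩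
  have he : Function.Injective e := by
    intro k l h
    funext j
    have := congrArg (fun x : EuclideanSpace ℝ (Fin d) => x j) (congrArg Subtype.val h)
    simpa [e, freqVec] using this
  have hs := (ZLattice.summable_norm_rpow L (-(2 * r)) (by rw [hfin]; linarith)).comp_injective he
  have hr0 : 0 < r := lt_of_le_of_lt (by positivity) hr
  refine Summable.of_norm_bounded_eventually hs ?_
  have : {k : Fin d → ℤ | freqVec k = 0}.Finite := by
    refine Set.Finite.subset (Set.finite_singleton 0) fun k hk => ?_
    apply he
    ext1
    simp only [e]
    rw [show freqVec k = 0 from hk]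
    ext j; simp [freqVec]
  filter_upwards [this.compl_mem_cofinite] with k hk
  have hk : 0 < ‖freqVec k‖ := norm_pos_iff.2 hk
  rw [Real.norm_of_nonneg (Real.rpow_nonneg (weight_pos k).le _), weight_eq]
  exact Real.rpow_le_rpow_of_nonpos hk
    (show ‖freqVec k‖ ≤ 1 + ‖freqVec k‖ by linarith) (by linarith)

/-- The `ℓ²` norm on `[0, ∞]`-valued families. -/
def l2norm (f : (Fin d → ℤ) → ℝ≥0∞) : ℝ≥0∞ := eLpNorm f 2 Measure.count

lemma l2norm_eq (f : (Fin d → ℤ) → ℝ≥0∞) : l2norm f = (∑' k, f k ^ 2) ^ (1 / 2 : ℝ) := by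
  rw [l2norm, eLpNorm_eq_lintegral_rpow_enorm_toReal two_ne_zero ENNReal.ofNat_ne_top,
    lintegral_count]
  simp

lemma l2norm_sq (f : (Fin d → ℤ) → ℝ≥0∞) : l2norm f ^ 2 = ∑' k, f k ^ 2 := by
  rw [l2norm_eq, ← ENNReal.rpow_natCast, ← ENNReal.rpow_mul]
  norm_num

lemma l2norm_add_le (f g : (Fin d → ℤ) → ℝ≥0∞) : l2norm (f + g) ≤ l2norm f + l2norm g :=
  eLpNorm_add_le (measurable_of_countable f).aestronglyMeasurable
    (measurable_of_countable g).aestronglyMeasurable one_le_two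

lemma l2norm_mono {f g : (Fin d → ℤ) → ℝ≥0∞} (h : ∀ k, f k ≤ g k) : l2norm f ≤ l2norm g :=
  eLpNorm_mono_enorm h

lemma l2norm_const_mul (c : ℝ≥0∞) (f : (Fin d → ℤ) → ℝ≥0∞) :
    l2norm (fun k => c * f k) = c * l2norm f := by
  simp only [l2norm_eq, mul_pow, ENNReal.tsum_mul_left]
  rw [ENNReal.mul_rpow_of_nonneg _ _ (by norm_num), ← ENNReal.rpow_natCast, ← ENNReal.rpow_mul]
  norm_num

lemma tsum_mul_le_l2norm (f g : (Fin d → ℤ) → ℝ≥0∞) :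
    ∑' k, f k * g k ≤ l2norm f * l2norm g := by
  have := ENNReal.lintegral_mul_le_Lp_mul_Lq (Measure.count : Measure (Fin d → ℤ))
    Real.HolderConjugate.two_two
    (measurable_of_countable f).aemeasurable (measurable_of_countable g).aemeasurable
  simpa [lintegral_count, l2norm_eq] using this

/-- Young's inequality `‖f ⋆ g‖₂ ≤ ‖f‖₁ ‖g‖₂`. -/
lemma l2norm_conv_le (f g : (Fin d → ℤ) → ℝ≥0∞) :
    l2norm (fun k => ∑' l, f (k - l) * g l) ≤ (∑' k, f k) * l2norm g := by
  have hsub (k : Fin d → ℤ) (h : (Fin d → ℤ) → ℝ≥0∞) : ∑' l, h (k - l) = ∑' l, h l :=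
    (Equiv.subLeft k).tsum_eq h
  have hsub' (l : Fin d → ℤ) (h : (Fin d → ℤ) → ℝ≥0∞) : ∑' k, h (k - l) = ∑' k, h k :=
    (Equiv.subRight l).tsum_eq h
  have hsq (x : ℝ≥0∞) : (x ^ (1 / 2 : ℝ)) ^ 2 = x := by
    rw [← ENNReal.rpow_natCast, ← ENNReal.rpow_mul]; norm_num
  have key (k : Fin d → ℤ) :
      (∑' l, f (k - l) * g l) ^ 2 ≤ (∑' l, f l) * ∑' l, f (k - l) * g l ^ 2 := by
    have h1 (l : Fin d → ℤ) : f (k - l) * g l =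
        f (k - l) ^ (1 / 2 : ℝ) * (f (k - l) ^ (1 / 2 : ℝ) * g l) := by
      rw [← mul_assoc, ← sq, hsq]
    calc (∑' l, f (k - l) * g l) ^ 2
        ≤ (l2norm (fun l => f (k - l) ^ (1 / 2 : ℝ)) *
            l2norm (fun l => f (k - l) ^ (1 / 2 : ℝ) * g l)) ^ 2 := by
          gcongr
          simp_rw [h1]
          exact tsum_mul_le_l2norm _ _
      _ = _ := by
          rw [mul_pow, l2norm_sq, l2norm_sq]
          simp only [hsq, mul_pow]
          rw [hsub k f]
  have h2 : l2norm (fun k => ∑' l, f (k - l) * g l) ^ 2 ≤ ((∑' k, f k) * l2norm g) ^ 2 := by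
    rw [l2norm_sq, mul_pow, l2norm_sq]
    calc ∑' k, (∑' l, f (k - l) * g l) ^ 2
        ≤ ∑' k, (∑' l, f l) * ∑' l, f (k - l) * g l ^ 2 := ENNReal.tsum_le_tsum key
      _ = (∑' l, f l) * ∑' l, ∑' k, f (k - l) * g l ^ 2 := by
          rw [ENNReal.tsum_mul_left, ENNReal.tsum_comm]
      _ = _ := by
          simp_rw [ENNReal.tsum_mul_right, hsub' _ f, ENNReal.tsum_mul_left]
          ring
  exact (ENNReal.pow_le_pow_left_iff two_ne_zero).1 h2

/-- The weighted norm `(∑_k (1+|k|)^{2s} |a_k|²)^{1/2}` of a family of coefficients. -/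
def seqNorm (s : ℝ) (a : (Fin d → ℤ) → ℂ) : ℝ≥0∞ :=
  l2norm fun k => ENNReal.ofReal (weight k ^ s) * ‖a k‖ₑ

lemma eSobolevNorm_eq (s : ℝ) (f : Torus d → ℂ) : eSobolevNorm s f = seqNorm s (coeff f) := by
  rw [seqNorm, l2norm_eq, eSobolevNorm]
  congr 2 with k
  have hw := (weight_pos k).le
  rw [mul_pow, ← ENNReal.ofReal_pow (Real.rpow_nonneg hw s), ← ofReal_norm,
    ← ENNReal.ofReal_pow (norm_nonneg _), ← ENNReal.ofReal_mul (by positivity),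
    ← Real.rpow_mul_natCast hw, mul_comm 2 s]
  rfl

lemma seqNorm_mono {s : ℝ} {a b : (Fin d → ℤ) → ℂ} (h : ∀ k, ‖a k‖ ≤ ‖b k‖) :
    seqNorm s a ≤ seqNorm s b :=
  l2norm_mono fun k => by
    gcongr
    exact enorm_le_iff_norm_le.2 (h k)

lemma seqNorm_congr {s : ℝ} {a b : (Fin d → ℤ) → ℂ} (h : ∀ k, ‖a k‖ = ‖b k‖) :
    seqNorm s a = seqNorm s b :=
  le_antisymm (seqNorm_mono fun k => (h k).le) (seqNorm_mono fun k => (h k).ge)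

lemma seqNorm_add_le (s : ℝ) (a b : (Fin d → ℤ) → ℂ) :
    seqNorm s (fun k => a k + b k) ≤ seqNorm s a + seqNorm s b := by
  refine le_trans (l2norm_mono fun k => ?_) (l2norm_add_le _ _)
  rw [Pi.add_apply, ← mul_add]
  gcongr
  exact enorm_add_le _ _

lemma seqNorm_sub_le (s : ℝ) (a b : (Fin d → ℤ) → ℂ) :
    seqNorm s (fun k => a k - b k) ≤ seqNorm s a + seqNorm s b := by
  refine le_trans (l2norm_mono fun k => ?_) (l2norm_add_le _ _)
  rw [Pi.add_apply, ← mul_add]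
  gcongr
  exact enorm_sub_le

lemma seqNorm_const_mul (s : ℝ) (c : ℂ) (a : (Fin d → ℤ) → ℂ) :
    seqNorm s (fun k => c * a k) = ‖c‖ₑ * seqNorm s a := by
  rw [seqNorm, seqNorm, ← l2norm_const_mul]
  congr 1 with k
  rw [enorm_mul]; ring

lemma seqNorm_zero (s : ℝ) : seqNorm s (fun _ : Fin d → ℤ => (0 : ℂ)) = 0 := by
  simp [seqNorm, l2norm_eq]

lemma seqNorm_mono_exponent {r s : ℝ} (h : r ≤ s) (a : (Fin d → ℤ) → ℂ) :
    seqNorm r a ≤ seqNorm s a :=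
  l2norm_mono fun k => by
    gcongr
    exact one_le_weight k

lemma enorm_le_seqNorm {s : ℝ} (hs : 0 ≤ s) (a : (Fin d → ℤ) → ℂ) (k : Fin d → ℤ) :
    ‖a k‖ₑ ≤ seqNorm s a := by
  have h : ‖a k‖ₑ ^ 2 ≤ seqNorm s a ^ 2 := by
    rw [seqNorm, l2norm_sq]
    refine le_trans ?_ (ENNReal.le_tsum k)
    gcongr
    refine le_mul_of_one_le_left' ?_
    rw [ENNReal.one_le_ofReal]
    exact Real.one_le_rpow (one_le_weight k) hs
  exact (ENNReal.pow_le_pow_left_iff two_ne_zero).1 h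

/-- Multiplying the coefficients by `(1+|k|)^γ` shifts the exponent of the norm. -/
lemma seqNorm_weight_mul (r γ : ℝ) (a : (Fin d → ℤ) → ℂ) :
    seqNorm r (fun k => ((weight k ^ γ : ℝ) : ℂ) * a k) = seqNorm (r + γ) a := by
  unfold seqNorm
  congr 1 with k
  have hw := weight_pos k
  rw [enorm_mul, ← ofReal_norm ((weight k ^ γ : ℝ) : ℂ), Complex.norm_real,
    Real.norm_of_nonneg (Real.rpow_nonneg hw.le _), ← mul_assoc,
    ← ENNReal.ofReal_mul (Real.rpow_nonneg hw.le _), ← Real.rpow_add hw]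

/-- Coefficients of the complex conjugate. -/
def conjCoeff (a : (Fin d → ℤ) → ℂ) : (Fin d → ℤ) → ℂ := fun k => conj (a (-k))

lemma seqNorm_conjCoeff (s : ℝ) (a : (Fin d → ℤ) → ℂ) :
    seqNorm s (conjCoeff a) = seqNorm s a := by
  simp only [seqNorm, l2norm_eq]
  congr 1
  rw [← (Equiv.neg (Fin d → ℤ)).tsum_eq]
  congr 1 with k
  simp [conjCoeff, weight_neg, enorm_eq_nnnorm]

/-- Coefficients of `e^{itΔ} f`. -/
def propagate (t : ℝ) (a : (Fin d → ℤ) → ℂ) : (Fin d → ℤ) → ℂ :=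
  fun k => Complex.exp (Complex.I * t * ((-freqSq k : ℝ) : ℂ)) * a k

lemma norm_propagate (t : ℝ) (a : (Fin d → ℤ) → ℂ) (k : Fin d → ℤ) :
    ‖propagate t a k‖ = ‖a k‖ := by
  rw [propagate, norm_mul, mul_assoc, mul_comm Complex.I, ← Complex.ofReal_mul,
    Complex.norm_exp_ofReal_mul_I, one_mul]

lemma seqNorm_propagate (s t : ℝ) (a : (Fin d → ℤ) → ℂ) :
    seqNorm s (propagate t a) = seqNorm s a :=
  seqNorm_congr (norm_propagate t a)

lemma propagate_sub (t : ℝ) (a b : (Fin d → ℤ) → ℂ) :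
    propagate t (fun k => a k - b k) = fun k => propagate t a k - propagate t b k := by
  funext k; simp only [propagate]; ring

lemma propagate_propagate (s t : ℝ) (a : (Fin d → ℤ) → ℂ) :
    propagate s (propagate t a) = propagate (s + t) a := by
  funext k
  simp only [propagate]
  rw [← mul_assoc, ← Complex.exp_add]
  congr 2
  push_cast; ring

lemma conjCoeff_propagate (t : ℝ) (a : (Fin d → ℤ) → ℂ) :
    conjCoeff (propagate t a) = propagate (-t) (conjCoeff a) := by
  funext k
  simp only [propagate, conjCoeff, map_mul, ← Complex.exp_conj, Complex.conj_I,
    Complex.conj_ofReal, freqSq_neg]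
  congr 2
  push_cast; ring

/-- `H^r` embeds into the Wiener algebra if `r > d/2`. -/
lemma exists_tsum_le_seqNorm {r : ℝ} (hr : (d : ℝ) / 2 < r) :
    ∃ C : ℝ≥0, ∀ a : (Fin d → ℤ) → ℂ, ∑' k, ‖a k‖ₑ ≤ C * seqNorm r a := by
  have hfin : l2norm (fun k : Fin d → ℤ => ENNReal.ofReal (weight k ^ (-r))) ≠ ∞ := by
    rw [l2norm_eq]
    refine ENNReal.rpow_ne_top_of_nonneg (by norm_num) ?_
    have := (summable_weight_rpow hr).tsum_ofReal_ne_top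
    convert this using 3 with k
    rw [← ENNReal.ofReal_pow (Real.rpow_nonneg (weight_pos k).le _),
      ← Real.rpow_mul_natCast (weight_pos k).le]
    congr 2; push_cast; ring
  refine ⟨(l2norm fun k : Fin d → ℤ => ENNReal.ofReal (weight k ^ (-r))).toNNReal, fun a => ?_⟩
  rw [ENNReal.coe_toNNReal hfin]
  refine le_trans (le_of_eq ?_) (tsum_mul_le_l2norm _ _)
  congr 1 with k
  have hw := weight_pos k
  rw [← mul_assoc, ← ENNReal.ofReal_mul (Real.rpow_nonneg hw.le _), ← Real.rpow_add hw]
  simp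

lemma summable_norm_of_seqNorm {r : ℝ} (hr : (d : ℝ) / 2 < r) {a : (Fin d → ℤ) → ℂ}
    (ha : seqNorm r a ≠ ∞) : Summable fun k => ‖a k‖ := by
  obtain ⟨C, hC⟩ := exists_tsum_le_seqNorm hr
  have : ∑' k, ‖a k‖ₑ ≠ ∞ :=
    ((hC a).trans_lt (ENNReal.mul_lt_top ENNReal.coe_lt_top ha.lt_top)).ne
  simp only [enorm_eq_nnnorm] at this
  exact NNReal.summable_coe.2 (ENNReal.tsum_coe_ne_top_iff_summable.1 this)

lemma exists_seqNorm_conv_le {s : ℝ} (hs : (d : ℝ) / 2 < s) :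
    ∃ C : ℝ≥0, ∀ a b c : (Fin d → ℤ) → ℂ, (∀ k, ‖c k‖ₑ ≤ ∑' l, ‖a (k - l)‖ₑ * ‖b l‖ₑ) →
      seqNorm s c ≤ C * (seqNorm s a * seqNorm s b) := by
  obtain ⟨C, hC⟩ := exists_tsum_le_seqNorm hs
  have hs0 : 0 ≤ s := le_trans (by positivity) hs.le
  let D : ℝ≥0 := (2 : ℝ≥0) ^ s
  refine ⟨D * (C + C), fun a b c h => ?_⟩
  let A : (Fin d → ℤ) → ℝ≥0∞ := fun k => ‖a k‖ₑ
  let B : (Fin d → ℤ) → ℝ≥0∞ := fun k => ‖b k‖ₑ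
  let W : (Fin d → ℤ) → ℝ≥0∞ := fun k => ENNReal.ofReal (weight k ^ s)
  have hW (k l : Fin d → ℤ) : W k ≤ D * (W (k - l) + W l) := by
    have := weight_rpow_le hs0 (k - l) l
    rw [sub_add_cancel] at this
    have hD : (D : ℝ≥0∞) = ENNReal.ofReal ((2 : ℝ) ^ s) := by
      rw [ENNReal.ofReal, Real.toNNReal_rpow_of_nonneg zero_le_two]; simp [D]
    rw [hD, ← ENNReal.ofReal_add (Real.rpow_nonneg (weight_pos _).le _)
      (Real.rpow_nonneg (weight_pos _).le _), ← ENNReal.ofReal_mul (by positivity)]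
    exact ENNReal.ofReal_le_ofReal this
  have hsub (k : Fin d → ℤ) (h : (Fin d → ℤ) → ℝ≥0∞) : ∑' l, h (k - l) = ∑' l, h l :=
    (Equiv.subLeft k).tsum_eq h
  have key (k : Fin d → ℤ) : W k * ‖c k‖ₑ ≤
      D * ((∑' l, B (k - l) * (W l * A l)) + ∑' l, A (k - l) * (W l * B l)) := by
    calc W k * ‖c k‖ₑ ≤ W k * ∑' l, A (k - l) * B l := by gcongr; exact h k
      _ = ∑' l, W k * (A (k - l) * B l) := ENNReal.tsum_mul_left.symm
      _ ≤ ∑' l, D * (W (k - l) + W l) * (A (k - l) * B l) := by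
          refine ENNReal.tsum_le_tsum fun l => ?_
          gcongr
          exact hW k l
      _ = ∑' l, (D * (B l * (W (k - l) * A (k - l))) + D * (A (k - l) * (W l * B l))) := by
          congr 1 with l; ring
      _ = _ := by
          rw [ENNReal.tsum_add, ENNReal.tsum_mul_left, ENNReal.tsum_mul_left, ← mul_add,
            ← hsub k fun l => B (k - l) * (W l * A l)]
          simp only [sub_sub_cancel]
  calc seqNorm s c ≤ D * ((∑' k, B k) * seqNorm s a + (∑' k, A k) * seqNorm s b) := by
        refine (l2norm_mono key).trans ?_
        rw [l2norm_const_mul]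
        gcongr
        refine (l2norm_add_le _ _).trans ?_
        gcongr
        · exact l2norm_conv_le _ _
        · exact l2norm_conv_le _ _
    _ ≤ D * ((C * seqNorm s b) * seqNorm s a + (C * seqNorm s a) * seqNorm s b) := by
        gcongr
        · exact hC b
        · exact hC a
    _ = _ := by push_cast; ring

/-- The convolution of two families of coefficients. -/
def conv (a b : (Fin d → ℤ) → ℂ) : (Fin d → ℤ) → ℂ := fun k => ∑' l, a (k - l) * b l

/-- Powers with respect to convolution. -/
def convPow (a : (Fin d → ℤ) → ℂ) : ℕ → (Fin d → ℤ) → ℂ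
  | 0 => Pi.single 0 1
  | n + 1 => conv (convPow a n) a

lemma enorm_conv_le (a b : (Fin d → ℤ) → ℂ) (k : Fin d → ℤ) :
    ‖conv a b k‖ₑ ≤ ∑' l, ‖a (k - l)‖ₑ * ‖b l‖ₑ :=
  enorm_tsum_le_tsum_enorm.trans (by simp only [enorm_mul, le_refl])

lemma summable_conv {a b : (Fin d → ℤ) → ℂ} (ha : Summable fun k => ‖a k‖)
    (hb : Summable fun k => ‖b k‖) (k : Fin d → ℤ) : Summable fun l => ‖a (k - l) * b l‖ := by
  refine Summable.of_nonneg_of_le (fun _ => norm_nonneg _) (fun l => ?_)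
    (hb.mul_left (∑' k, ‖a k‖))
  rw [norm_mul]
  gcongr
  exact ha.le_tsum (k - l) fun _ _ => norm_nonneg _

lemma conv_sub_left {a a' b : (Fin d → ℤ) → ℂ} (ha : Summable fun k => ‖a k‖)
    (ha' : Summable fun k => ‖a' k‖) (hb : Summable fun k => ‖b k‖) :
    conv (fun k => a k - a' k) b = fun k => conv a b k - conv a' b k := by
  funext k
  simp only [conv]
  rw [← (summable_conv ha hb k).of_norm.tsum_sub (summable_conv ha' hb k).of_norm]
  simp only [sub_mul]

lemma conv_sub_right {a b b' : (Fin d → ℤ) → ℂ} (ha : Summable fun k => ‖a k‖)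
    (hb : Summable fun k => ‖b k‖) (hb' : Summable fun k => ‖b' k‖) :
    conv a (fun k => b k - b' k) = fun k => conv a b k - conv a b' k := by
  funext k
  simp only [conv]
  rw [← (summable_conv ha hb k).of_norm.tsum_sub (summable_conv ha hb' k).of_norm]
  simp only [mul_sub]

section Estimates

variable {r : ℝ}

lemma exists_conv_le (hr : (d : ℝ) / 2 < r) :
    ∃ C : ℝ≥0, ∀ a b : (Fin d → ℤ) → ℂ,
      seqNorm r (conv a b) ≤ C * (seqNorm r a * seqNorm r b) := by
  obtain ⟨C, hC⟩ := exists_seqNorm_conv_le hr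
  exact ⟨C, fun a b => hC a b _ (enorm_conv_le a b)⟩

lemma exists_conv_sub_le (hr : (d : ℝ) / 2 < r) :
    ∃ C : ℝ≥0, ∀ a a' b b' : (Fin d → ℤ) → ℂ, seqNorm r a ≠ ∞ → seqNorm r a' ≠ ∞ →
      seqNorm r b ≠ ∞ → seqNorm r b' ≠ ∞ →
      seqNorm r (fun k => conv a b k - conv a' b' k) ≤
        C * (seqNorm r (fun k => a k - a' k) * seqNorm r b +
          seqNorm r a' * seqNorm r (fun k => b k - b' k)) := by
  obtain ⟨C, hC⟩ := exists_conv_le hr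
  refine ⟨C, fun a a' b b' ha ha' hb hb' => ?_⟩
  have h : (fun k => conv a b k - conv a' b' k) =
      fun k => conv (fun k => a k - a' k) b k + conv a' (fun k => b k - b' k) k := by
    have ha := summable_norm_of_seqNorm hr ha
    have ha' := summable_norm_of_seqNorm hr ha'
    have hb := summable_norm_of_seqNorm hr hb
    have hb' := summable_norm_of_seqNorm hr hb'
    rw [conv_sub_left ha ha' hb, conv_sub_right ha' hb hb']
    funext k; ring
  rw [h, mul_add]
  exact (seqNorm_add_le _ _ _).trans (add_le_add (hC _ _) (hC _ _))

lemma seqNorm_single_ne_top (s : ℝ) :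
    seqNorm s (Pi.single 0 1 : (Fin d → ℤ) → ℂ) ≠ ∞ := by
  rw [seqNorm, l2norm_eq]
  refine ENNReal.rpow_ne_top_of_nonneg (by norm_num) ?_
  rw [tsum_eq_single 0]
  · simp
  · intro k hk; simp [hk]

lemma exists_convPow_le (hr : (d : ℝ) / 2 < r) (R : ℝ≥0) (n : ℕ) :
    ∃ C : ℝ≥0, ∀ a : (Fin d → ℤ) → ℂ, seqNorm r a ≤ R → seqNorm r (convPow a n) ≤ C := by
  obtain ⟨K, hK⟩ := exists_conv_le hr
  induction n with
  | zero =>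
    refine ⟨(seqNorm r (Pi.single 0 1 : (Fin d → ℤ) → ℂ)).toNNReal, fun a _ => ?_⟩
    rw [ENNReal.coe_toNNReal (seqNorm_single_ne_top r)]
    rfl
  | succ n ih =>
    obtain ⟨C, hC⟩ := ih
    refine ⟨K * (C * R), fun a ha => (hK _ _).trans ?_⟩
    push_cast
    gcongr
    exact hC a ha

lemma exists_convPow_sub_le (hr : (d : ℝ) / 2 < r) (R : ℝ≥0) (n : ℕ) :
    ∃ C : ℝ≥0, ∀ a b : (Fin d → ℤ) → ℂ, seqNorm r a ≤ R → seqNorm r b ≤ R →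
      seqNorm r (fun k => convPow a n k - convPow b n k) ≤
        C * seqNorm r (fun k => a k - b k) := by
  obtain ⟨K, hK⟩ := exists_conv_sub_le hr
  induction n with
  | zero => exact ⟨0, fun a b _ _ => by simp [convPow, seqNorm_zero]⟩
  | succ n ih =>
    obtain ⟨C, hC⟩ := ih
    obtain ⟨B, hB⟩ := exists_convPow_le hr R n
    refine ⟨K * (C * R + B), fun a b ha hb => ?_⟩
    have ht {x : ℝ≥0∞} {y : ℝ≥0} (h : x ≤ y) : x ≠ ∞ := ne_top_of_le_ne_top ENNReal.coe_ne_top h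
    refine (hK _ _ _ _ (ht (hB a ha)) (ht (hB b hb)) (ht ha) (ht hb)).trans ?_
    push_cast
    rw [mul_assoc, add_mul]
    gcongr (K : ℝ≥0∞) * (?_ + ?_)
    · calc _ ≤ (C * seqNorm r fun k => a k - b k) * R := by
            gcongr
            exact hC a b ha hb
        _ = _ := by ring
    · gcongr
      exact hB b hb

lemma norm_exp_mul_I_sub_one_le {γ : ℝ} (hγ₀ : 0 < γ) (hγ₁ : γ ≤ 1) (θ : ℝ) :
    ‖Complex.exp (Complex.I * θ) - 1‖ ≤ 2 * |θ| ^ γ := by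
  rcases le_total |θ| 1 with h | h
  · have h1 : ‖Complex.exp (Complex.I * θ) - 1‖ ≤ |θ| := Real.norm_exp_I_mul_ofReal_sub_one_le
    have h2 : |θ| ≤ |θ| ^ γ := by
      rcases (abs_nonneg θ).eq_or_lt with h0 | h0
      · rw [← h0, Real.zero_rpow hγ₀.ne']
      · simpa using Real.rpow_le_rpow_of_exponent_ge h0 h hγ₁
    linarith [Real.rpow_nonneg (abs_nonneg θ) γ]
  · have h1 : ‖Complex.exp (Complex.I * θ) - 1‖ ≤ 2 := by
      refine (norm_sub_le _ _).trans ?_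
      rw [mul_comm, Complex.norm_exp_ofReal_mul_I, norm_one]
      norm_num
    linarith [Real.one_le_rpow h hγ₀.le]

/-- The group `e^{itΔ}` commutes with products up to an error of size `|t|^γ`, at the cost of `γ`
derivatives on each factor. -/
lemma exists_conv_propagate_sub_le (hr : (d : ℝ) / 2 < r) {γ : ℝ} (hγ₀ : 0 < γ) (hγ₁ : γ ≤ 1) :
    ∃ C : ℝ≥0, ∀ (t : ℝ) (a b : (Fin d → ℤ) → ℂ), seqNorm r a ≠ ∞ → seqNorm r b ≠ ∞ →
      seqNorm r (fun k => conv (propagate t a) (propagate t b) k - propagate t (conv a b) k) ≤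
        C * ENNReal.ofReal (|t| ^ γ) * (seqNorm (r + γ) a * seqNorm (r + γ) b) := by
  obtain ⟨C, hC⟩ := exists_seqNorm_conv_le hr
  refine ⟨C * 4, fun t a b ha hb => ?_⟩
  have hsa := summable_norm_of_seqNorm hr ha
  have hsb := summable_norm_of_seqNorm hr hb
  let a' : (Fin d → ℤ) → ℂ := fun k => ((4 * |t| ^ γ : ℝ) : ℂ) * (((weight k ^ γ : ℝ) : ℂ) * a k)
  let b' : (Fin d → ℤ) → ℂ := fun k => ((weight k ^ γ : ℝ) : ℂ) * b k
  have ht : 0 ≤ |t| ^ γ := Real.rpow_nonneg (abs_nonneg t) γ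
  have hphase (k l : Fin d → ℤ) :
      ‖Complex.exp (Complex.I * t * ((-freqSq (k - l) : ℝ) : ℂ)) *
        Complex.exp (Complex.I * t * ((-freqSq l : ℝ) : ℂ)) -
        Complex.exp (Complex.I * t * ((-freqSq k : ℝ) : ℂ))‖ ≤
      4 * |t| ^ γ * (weight (k - l) ^ γ * weight l ^ γ) := by
    set θ : ℝ := t * (freqSq k - freqSq (k - l) - freqSq l) with hθ
    have h1 : Complex.exp (Complex.I * t * ((-freqSq (k - l) : ℝ) : ℂ)) *
        Complex.exp (Complex.I * t * ((-freqSq l : ℝ) : ℂ)) -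
        Complex.exp (Complex.I * t * ((-freqSq k : ℝ) : ℂ)) =
        Complex.exp ((t * -freqSq k : ℝ) * Complex.I) * (Complex.exp (Complex.I * θ) - 1) := by
      rw [mul_sub, ← Complex.exp_add, ← Complex.exp_add, mul_one]
      congr 2 <;> push_cast [hθ] <;> ring
    rw [h1, norm_mul, Complex.norm_exp_ofReal_mul_I, one_mul]
    refine (norm_exp_mul_I_sub_one_le hγ₀ hγ₁ θ).trans ?_
    have h2 : |θ| ≤ |t| * (2 * (weight (k - l) * weight l)) := by
      rw [hθ, abs_mul]
      gcongr
      simpa using abs_freqSq_add_sub_le (k - l) l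
    have hw := (weight_pos (k - l)).le
    have hw' := (weight_pos l).le
    calc 2 * |θ| ^ γ ≤ 2 * (|t| * (2 * (weight (k - l) * weight l))) ^ γ := by gcongr
      _ = 2 * (|t| ^ γ * (2 ^ γ * (weight (k - l) ^ γ * weight l ^ γ))) := by
          rw [Real.mul_rpow (abs_nonneg t) (by positivity), Real.mul_rpow zero_le_two
            (by positivity), Real.mul_rpow hw hw']
      _ ≤ 2 * (|t| ^ γ * (2 ^ (1 : ℝ) * (weight (k - l) ^ γ * weight l ^ γ))) := by
          gcongr
          norm_num
      _ = _ := by rw [Real.rpow_one]; ring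
  have key (k : Fin d → ℤ) :
      ‖conv (propagate t a) (propagate t b) k - propagate t (conv a b) k‖ₑ ≤
        ∑' l, ‖a' (k - l)‖ₑ * ‖b' l‖ₑ := by
    have e : conv (propagate t a) (propagate t b) k - propagate t (conv a b) k =
        ∑' l, (propagate t a (k - l) * propagate t b l -
          Complex.exp (Complex.I * t * ((-freqSq k : ℝ) : ℂ)) * (a (k - l) * b l)) := by
      rw [Summable.tsum_sub, tsum_mul_left]
      · rfl
      · refine (summable_conv ?_ ?_ k).of_norm
        · simpa only [norm_propagate] using hsa
        · simpa only [norm_propagate] using hsb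
      · exact (summable_conv hsa hsb k).of_norm.mul_left _
    rw [e]
    refine enorm_tsum_le_tsum_enorm.trans (ENNReal.tsum_le_tsum fun l => ?_)
    rw [← enorm_mul, enorm_le_iff_norm_le]
    have e2 : propagate t a (k - l) * propagate t b l -
        Complex.exp (Complex.I * t * ((-freqSq k : ℝ) : ℂ)) * (a (k - l) * b l) =
        (Complex.exp (Complex.I * t * ((-freqSq (k - l) : ℝ) : ℂ)) *
        Complex.exp (Complex.I * t * ((-freqSq l : ℝ) : ℂ)) -
        Complex.exp (Complex.I * t * ((-freqSq k : ℝ) : ℂ))) * (a (k - l) * b l) := by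
      simp only [propagate]; ring
    have hw := Real.rpow_nonneg (weight_pos (k - l)).le γ
    have hw' := Real.rpow_nonneg (weight_pos l).le γ
    have e3 : ‖a' (k - l) * b' l‖ =
        4 * |t| ^ γ * (weight (k - l) ^ γ * weight l ^ γ) * ‖a (k - l) * b l‖ := by
      simp only [a', b', norm_mul, Complex.norm_real, Real.norm_of_nonneg hw,
        Real.norm_of_nonneg hw', Real.norm_of_nonneg ht, Complex.ofReal_mul]
      norm_num
      ring
    rw [e2, e3, norm_mul]
    gcongr
    exact hphase k l
  refine (hC a' b' _ key).trans (le_of_eq ?_)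
  simp only [a', b']
  rw [seqNorm_const_mul, seqNorm_weight_mul, seqNorm_weight_mul, ← ofReal_norm, Complex.norm_real,
    Real.norm_of_nonneg (by positivity), ENNReal.ofReal_mul (by norm_num)]
  push_cast
  rw [ENNReal.ofReal_ofNat]
  ring

end Estimates

lemma propagate_single (t : ℝ) :
    propagate t (Pi.single 0 1 : (Fin d → ℤ) → ℂ) = Pi.single 0 1 := by
  funext k
  rcases eq_or_ne k 0 with rfl | hk
  · simp [propagate, freqSq]
  · simp [propagate, hk]

/-- Coefficients of `(e^{itΔ} f)^{p+1} (e^{-itΔ} f̄)^p`, pulled back by `e^{-itΔ}`. -/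
def nonlin (p : ℕ) (t : ℝ) (a : (Fin d → ℤ) → ℂ) : (Fin d → ℤ) → ℂ :=
  propagate (-t) (conv (convPow (propagate t a) (p + 1)) (convPow (propagate (-t) (conjCoeff a)) p))

/-- The multiplier `φ₁(-2iτΔ)` on coefficients. -/
def phiMul (τ : ℝ) (a : (Fin d → ℤ) → ℂ) : (Fin d → ℤ) → ℂ :=
  fun k => phi1 (-2 * Complex.I * τ * ((-freqSq k : ℝ) : ℂ)) * a k

/-- The increment of the integrator, on coefficients and without the factor `-iμτ`. -/
def increment (p : ℕ) (τ t : ℝ) (a : (Fin d → ℤ) → ℂ) : (Fin d → ℤ) → ℂ :=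
  propagate (-t) (conv (convPow (propagate t a) (p + 1))
    (phiMul τ (convPow (propagate (-t) (conjCoeff a)) p)))

lemma norm_phi1_le (θ : ℝ) : ‖phi1 (Complex.I * θ)‖ ≤ 1 := by
  unfold phi1
  split_ifs with h
  · simp
  · have hθ : θ ≠ 0 := by rintro rfl; simp at h
    rw [norm_div, norm_mul, Complex.norm_I, one_mul, Complex.norm_real,
      div_le_one (norm_pos_iff.2 hθ)]
    exact Real.norm_exp_I_mul_ofReal_sub_one_le

lemma phiMul_arg (τ : ℝ) (k : Fin d → ℤ) :
    -2 * Complex.I * τ * ((-freqSq k : ℝ) : ℂ) = Complex.I * ((2 * τ * freqSq k : ℝ) : ℂ) := by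
  push_cast; ring

lemma norm_phiMul_le (τ : ℝ) (a : (Fin d → ℤ) → ℂ) (k : Fin d → ℤ) :
    ‖phiMul τ a k‖ ≤ ‖a k‖ := by
  rw [phiMul, norm_mul, phiMul_arg]
  exact mul_le_of_le_one_left (norm_nonneg _) (norm_phi1_le _)

lemma seqNorm_phiMul_le (s τ : ℝ) (a : (Fin d → ℤ) → ℂ) :
    seqNorm s (phiMul τ a) ≤ seqNorm s a :=
  seqNorm_mono (norm_phiMul_le τ a)

lemma phiMul_sub (τ : ℝ) (a b : (Fin d → ℤ) → ℂ) :
    phiMul τ (fun k => a k - b k) = fun k => phiMul τ a k - phiMul τ b k := by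
  funext k; simp only [phiMul]; ring

lemma conjCoeff_sub (a b : (Fin d → ℤ) → ℂ) :
    conjCoeff (fun k => a k - b k) = fun k => conjCoeff a k - conjCoeff b k := by
  funext k; simp [conjCoeff]

lemma hasDerivAt_mul_phi1 (c : ℂ) (t : ℝ) :
    HasDerivAt (fun s : ℝ => (s : ℂ) * phi1 (c * s)) (Complex.exp (c * t)) t := by
  have hid : HasDerivAt (fun s : ℝ => (s : ℂ)) 1 t := Complex.ofRealCLM.hasDerivAt
  rcases eq_or_ne c 0 with rfl | hc
  · simpa [phi1] using hid
  · have h : (fun s : ℝ => (s : ℂ) * phi1 (c * s)) = fun s : ℝ => (Complex.exp (c * s) - 1) / c := by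
      funext s
      rcases eq_or_ne s 0 with rfl | hs
      · simp
      · have : (s : ℂ) ≠ 0 := Complex.ofReal_ne_zero.2 hs
        rw [phi1, if_neg (mul_ne_zero hc this)]
        field_simp
    rw [h]
    have := (((hid.const_mul c).cexp).sub_const 1).div_const c
    simpa [hc] using this

lemma hasDerivAt_mul_conv_phiMul {a b : (Fin d → ℤ) → ℂ} (ha : Summable fun k => ‖a k‖)
    (hb : Summable fun k => ‖b k‖) (k : Fin d → ℤ) (t : ℝ) :
    HasDerivAt (fun s : ℝ => (s : ℂ) * conv a (phiMul s b) k) (conv a (propagate (-2 * t) b) k) t := by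
  have h : (fun s : ℝ => (s : ℂ) * conv a (phiMul s b) k) = fun s : ℝ => ∑' l,
      a (k - l) * b l * ((s : ℂ) * phi1 (2 * Complex.I * freqSq l * s)) := by
    funext s
    rw [conv, ← tsum_mul_left]
    congr 1 with l
    rw [phiMul, show -2 * Complex.I * (s : ℂ) * ((-freqSq l : ℝ) : ℂ) =
      2 * Complex.I * freqSq l * s by push_cast; ring]
    ring
  have h' : conv a (propagate (-2 * t) b) k =
      ∑' l, a (k - l) * b l * Complex.exp (2 * Complex.I * freqSq l * t) := by
    rw [conv]
    congr 1 with l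
    rw [propagate, show Complex.I * ((-2 * t : ℝ) : ℂ) * ((-freqSq l : ℝ) : ℂ) =
      2 * Complex.I * freqSq l * t by push_cast; ring]
    ring
  rw [h, h']
  refine hasDerivAt_tsum (u := fun l => ‖a (k - l) * b l‖) (summable_conv ha hb k)
    (fun l s => (hasDerivAt_mul_phi1 _ s).const_mul _) (fun l s => ?_) (y₀ := 0) ?_ t
  · rw [norm_mul, show 2 * Complex.I * (freqSq l : ℂ) * s = ((2 * freqSq l * s : ℝ) : ℂ) * Complex.I
      by push_cast; ring, Complex.norm_exp_ofReal_mul_I, mul_one]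
  · simp

section MeanValue

lemma hasDerivWithinAt_toLp {ι : Type*} [Fintype ι] {f : ℝ → ι → ℂ} {f' : ι → ℂ} {S : Set ℝ} {t : ℝ}
    (h : ∀ i, HasDerivWithinAt (fun s => f s i) (f' i) S t) :
    HasDerivWithinAt (fun s => (WithLp.toLp 2 (f s) : EuclideanSpace ℂ ι)) (WithLp.toLp 2 f') S t :=
  ((EuclideanSpace.equiv ι ℂ).symm.toContinuousLinearMap.restrictScalars
    ℝ).hasFDerivAt.comp_hasDerivWithinAt t (hasDerivWithinAt_pi.2 h)

lemma sum_weight_sq_eq (r : ℝ) (F : Finset (Fin d → ℤ)) (c : (Fin d → ℤ) → ℂ) :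
    ∑ k ∈ F, (ENNReal.ofReal (weight k ^ r) * ‖c k‖ₑ) ^ 2 =
      ‖(WithLp.toLp 2 fun k : F => ((weight k.1 ^ r : ℝ) : ℂ) * c k.1 :
        EuclideanSpace ℂ F)‖ₑ ^ 2 := by
  rw [← ofReal_norm, ← ENNReal.ofReal_pow (norm_nonneg _), EuclideanSpace.norm_sq_eq,
    ENNReal.ofReal_sum_of_nonneg fun _ _ => by positivity, ← Finset.sum_coe_sort]
  refine Finset.sum_congr rfl fun k _ => ?_
  rw [ENNReal.ofReal_pow (norm_nonneg _), norm_mul, Complex.norm_real,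
    Real.norm_of_nonneg (Real.rpow_nonneg (weight_pos _).le _),
    ENNReal.ofReal_mul (Real.rpow_nonneg (weight_pos _).le _), ofReal_norm]

/-- The mean value inequality for curves of coefficients with coefficientwise derivatives. -/
lemma seqNorm_sub_le_of_hasDerivWithinAt {r : ℝ} {h h' : ℝ → (Fin d → ℤ) → ℂ} {α β : ℝ}
    (hαβ : α ≤ β) {R : ℝ≥0}
    (hd : ∀ k, ∀ s ∈ Icc α β, HasDerivWithinAt (fun s => h s k) (h' s k) (Icc α β) s)
    (hR : ∀ s ∈ Icc α β, seqNorm r (h' s) ≤ R) :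
    seqNorm r (fun k => h β k - h α k) ≤ R * ENNReal.ofReal (β - α) := by
  refine (ENNReal.pow_le_pow_left_iff two_ne_zero).1 ?_
  rw [seqNorm, l2norm_sq]
  rw [ENNReal.tsum_eq_iSup_sum]
  refine iSup_le fun F => ?_
  let G : ((Fin d → ℤ) → ℂ) → EuclideanSpace ℂ F := fun c =>
    WithLp.toLp 2 fun k : F => ((weight k.1 ^ r : ℝ) : ℂ) * c k.1
  have hG (c : (Fin d → ℤ) → ℂ) :
      ∑ k ∈ F, (ENNReal.ofReal (weight k ^ r) * ‖c k‖ₑ) ^ 2 = ‖G c‖ₑ ^ 2 :=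
    sum_weight_sq_eq r F c
  have hG' (s : ℝ) (hs : s ∈ Icc α β) : ‖G (h' s)‖ ≤ R := by
    have : ‖G (h' s)‖ₑ ≤ R := by
      refine (ENNReal.pow_le_pow_left_iff two_ne_zero).1 ?_
      rw [← hG]
      calc _ ≤ seqNorm r (h' s) ^ 2 := by
            rw [seqNorm, l2norm_sq]
            exact ENNReal.sum_le_tsum F
        _ ≤ _ := by gcongr; exact hR s hs
    rw [enorm_eq_nnnorm, ENNReal.coe_le_coe] at this
    exact this
  have hsub : G (fun k => h β k - h α k) = G (h β) - G (h α) := by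
    ext k
    simp [G, mul_sub]
  have key := (convex_Icc α β).norm_image_sub_le_of_norm_hasDerivWithin_le
    (f := fun s => G (h s)) (f' := fun s => G (h' s)) (C := R)
    (fun s hs => hasDerivWithinAt_toLp fun k : F => (hd k.1 s hs).const_mul _) hG'
    (left_mem_Icc.2 hαβ) (right_mem_Icc.2 hαβ)
  rw [hG, hsub]
  gcongr
  rw [Real.norm_of_nonneg (sub_nonneg.2 hαβ)] at key
  rw [← ofReal_norm]
  calc _ ≤ ENNReal.ofReal (R * (β - α)) := ENNReal.ofReal_le_ofReal key
    _ = _ := by rw [ENNReal.ofReal_mul R.coe_nonneg, ENNReal.ofReal_coe_nnreal]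

end MeanValue

section NonlinearEstimates

variable {r : ℝ}

lemma ne_top_of_le_coe {x : ℝ≥0∞} {R : ℝ≥0} (h : x ≤ R) : x ≠ ∞ :=
  ne_top_of_le_ne_top ENNReal.coe_ne_top h

/-- Lipschitz estimate for `a^{p+1} · T (b^p)` with a linear contraction `T`. -/
lemma exists_conv_pow_pow_sub_le (hr : (d : ℝ) / 2 < r) (R : ℝ≥0) (p : ℕ) :
    ∃ C : ℝ≥0, ∀ T : ((Fin d → ℤ) → ℂ) → (Fin d → ℤ) → ℂ,
      (∀ a, seqNorm r (T a) ≤ seqNorm r a) →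
      (∀ a b, T (fun k => a k - b k) = fun k => T a k - T b k) →
      ∀ a a' b b', seqNorm r a ≤ R → seqNorm r a' ≤ R → seqNorm r b ≤ R → seqNorm r b' ≤ R →
      seqNorm r (fun k => conv (convPow a (p + 1)) (T (convPow b p)) k -
          conv (convPow a' (p + 1)) (T (convPow b' p)) k) ≤
        C * (seqNorm r (fun k => a k - a' k) + seqNorm r (fun k => b k - b' k)) := by
  obtain ⟨K, hK⟩ := exists_conv_sub_le hr
  obtain ⟨A, hA⟩ := exists_convPow_le hr R (p + 1)
  obtain ⟨B, hB⟩ := exists_convPow_le hr R p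
  obtain ⟨A', hA'⟩ := exists_convPow_sub_le hr R (p + 1)
  obtain ⟨B', hB'⟩ := exists_convPow_sub_le hr R p
  refine ⟨K * (A' * B + A * B'), fun T hT hT' a a' b b' ha ha' hb hb' => ?_⟩
  have h1 := (hT _).trans (hB b hb)
  have h2 := (hT _).trans (hB b' hb')
  refine (hK _ _ _ _ (ne_top_of_le_coe (hA a ha)) (ne_top_of_le_coe (hA a' ha'))
    (ne_top_of_le_coe h1) (ne_top_of_le_coe h2)).trans ?_
  rw [← hT']
  calc _ ≤ K * ((A' * seqNorm r fun k => a k - a' k) * B +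
        A * (B' * seqNorm r fun k => b k - b' k)) := by
        gcongr
        · exact hA' a a' ha ha'
        · exact hA a' ha'
        · exact (hT _).trans (hB' b b' hb hb')
    _ ≤ K * ((A' * B + A * B') * (seqNorm r fun k => a k - a' k) +
        (A' * B + A * B') * seqNorm r fun k => b k - b' k) := by
        rw [mul_right_comm, ← mul_assoc (A : ℝ≥0∞)]
        gcongr
        · exact le_self_add
        · exact le_add_self
    _ = _ := by push_cast; ring

lemma exists_nonlin_le (hr : (d : ℝ) / 2 < r) (R : ℝ≥0) (p : ℕ) :
    ∃ C : ℝ≥0, ∀ (t : ℝ) (a : (Fin d → ℤ) → ℂ), seqNorm r a ≤ R → seqNorm r (nonlin p t a) ≤ C := by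
  obtain ⟨K, hK⟩ := exists_conv_le hr
  obtain ⟨A, hA⟩ := exists_convPow_le hr R (p + 1)
  obtain ⟨B, hB⟩ := exists_convPow_le hr R p
  refine ⟨K * (A * B), fun t a ha => ?_⟩
  rw [nonlin, seqNorm_propagate]
  refine (hK _ _).trans ?_
  push_cast
  gcongr
  · exact hA _ (by rwa [seqNorm_propagate])
  · exact hB _ (by rwa [seqNorm_propagate, seqNorm_conjCoeff])

lemma exists_nonlin_sub_le (hr : (d : ℝ) / 2 < r) (R : ℝ≥0) (p : ℕ) :
    ∃ C : ℝ≥0, ∀ (t : ℝ) (a b : (Fin d → ℤ) → ℂ), seqNorm r a ≤ R → seqNorm r b ≤ R →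
      seqNorm r (fun k => nonlin p t a k - nonlin p t b k) ≤
        C * seqNorm r (fun k => a k - b k) := by
  obtain ⟨C, hC⟩ := exists_conv_pow_pow_sub_le hr R p
  refine ⟨C * 2, fun t a b ha hb => ?_⟩
  unfold nonlin
  rw [← propagate_sub, seqNorm_propagate]
  refine (hC id (fun _ => le_rfl) (fun _ _ => rfl) _ _ _ _ ?_ ?_ ?_ ?_).trans (le_of_eq ?_)
  any_goals simpa only [seqNorm_propagate, seqNorm_conjCoeff]
  rw [← propagate_sub, ← propagate_sub, ← conjCoeff_sub]
  simp only [seqNorm_propagate, seqNorm_conjCoeff]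
  push_cast; ring

lemma exists_increment_sub_le (hr : (d : ℝ) / 2 < r) (R : ℝ≥0) (p : ℕ) :
    ∃ C : ℝ≥0, ∀ (τ t : ℝ) (a b : (Fin d → ℤ) → ℂ), seqNorm r a ≤ R → seqNorm r b ≤ R →
      seqNorm r (fun k => increment p τ t a k - increment p τ t b k) ≤
        C * seqNorm r (fun k => a k - b k) := by
  obtain ⟨C, hC⟩ := exists_conv_pow_pow_sub_le hr R p
  refine ⟨C * 2, fun τ t a b ha hb => ?_⟩
  unfold increment
  rw [← propagate_sub, seqNorm_propagate]
  refine (hC (phiMul τ) (seqNorm_phiMul_le r τ) (phiMul_sub τ) _ _ _ _ ?_ ?_ ?_ ?_).trans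
    (le_of_eq ?_)
  any_goals simpa only [seqNorm_propagate, seqNorm_conjCoeff]
  rw [← propagate_sub, ← propagate_sub, ← conjCoeff_sub]
  simp only [seqNorm_propagate, seqNorm_conjCoeff]
  push_cast; ring

variable {γ : ℝ}

lemma exists_convPow_propagate_sub_le (hr : (d : ℝ) / 2 < r) (hγ₀ : 0 < γ) (hγ₁ : γ ≤ 1)
    (R : ℝ≥0) (n : ℕ) :
    ∃ C : ℝ≥0, ∀ (t : ℝ) (a : (Fin d → ℤ) → ℂ), seqNorm (r + γ) a ≤ R →
      seqNorm r (fun k => convPow (propagate t a) n k - propagate t (convPow a n) k) ≤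
        C * ENNReal.ofReal (|t| ^ γ) := by
  obtain ⟨K, hK⟩ := exists_conv_sub_le hr
  obtain ⟨E, hE⟩ := exists_conv_propagate_sub_le hr hγ₀ hγ₁
  induction n with
  | zero =>
    exact ⟨0, fun t a _ => by simp only [convPow, propagate_single, sub_self, seqNorm_zero, zero_le]⟩
  | succ n ih =>
    obtain ⟨C, hC⟩ := ih
    obtain ⟨B, hB⟩ := exists_convPow_le (show (d : ℝ) / 2 < r + γ by linarith) R n
    refine ⟨K * C * R + E * (B * R), fun t a ha => ?_⟩
    have hm (b : (Fin d → ℤ) → ℂ) : seqNorm r b ≤ seqNorm (r + γ) b :=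
      seqNorm_mono_exponent (by linarith) b
    have h1 : seqNorm r (convPow (propagate t a) n) ≤ B :=
      (hm _).trans (hB _ (by rwa [seqNorm_propagate]))
    have h2 : seqNorm r (convPow a n) ≤ B := (hm _).trans (hB a ha)
    have h3 : seqNorm r a ≤ R := (hm _).trans ha
    have hsplit : (fun k => convPow (propagate t a) (n + 1) k - propagate t (convPow a (n + 1)) k) =
        fun k => (conv (convPow (propagate t a) n) (propagate t a) k -
            conv (propagate t (convPow a n)) (propagate t a) k) +
          (conv (propagate t (convPow a n)) (propagate t a) k -
            propagate t (conv (convPow a n) a) k) := by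
      funext k; simp only [convPow]; ring
    rw [hsplit]
    refine (seqNorm_add_le _ _ _).trans ?_
    have e1 := hK (convPow (propagate t a) n) (propagate t (convPow a n)) (propagate t a)
      (propagate t a) (ne_top_of_le_coe h1) (by rw [seqNorm_propagate]; exact ne_top_of_le_coe h2)
      (by rw [seqNorm_propagate]; exact ne_top_of_le_coe h3)
      (by rw [seqNorm_propagate]; exact ne_top_of_le_coe h3)
    simp only [sub_self, seqNorm_zero, mul_zero, add_zero] at e1
    calc _ ≤ K * (C * ENNReal.ofReal (|t| ^ γ) * R) + E * ENNReal.ofReal (|t| ^ γ) * (B * R) := by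
          refine add_le_add (e1.trans ?_)
            ((hE t _ _ (ne_top_of_le_coe h2) (ne_top_of_le_coe h3)).trans ?_)
          · gcongr
            · exact hC t a ha
            · rwa [seqNorm_propagate]
          · gcongr
            exact hB a ha
      _ = _ := by push_cast; ring

/-- The error made by freezing the group in the nonlinearity except for the factor treated exactly
by the integrator. -/
lemma exists_nonlin_sub_frozen_le (hr : (d : ℝ) / 2 < r) (hγ₀ : 0 < γ) (hγ₁ : γ ≤ 1)
    (R : ℝ≥0) (p : ℕ) :
    ∃ C : ℝ≥0, ∀ (s t : ℝ) (a : (Fin d → ℤ) → ℂ), seqNorm (r + γ) a ≤ R →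
      seqNorm r (fun k => nonlin p (t + s) a k - propagate (-t) (conv
          (convPow (propagate t a) (p + 1))
          (propagate (-2 * s) (convPow (propagate (-t) (conjCoeff a)) p))) k) ≤
        C * ENNReal.ofReal (|s| ^ γ) := by
  obtain ⟨K, hK⟩ := exists_conv_sub_le hr
  obtain ⟨E, hE⟩ := exists_conv_propagate_sub_le hr hγ₀ hγ₁
  have hr' : (d : ℝ) / 2 < r + γ := by linarith
  obtain ⟨A, hA⟩ := exists_convPow_le hr' R (p + 1)
  obtain ⟨B, hB⟩ := exists_convPow_le hr' R p
  obtain ⟨A', hA'⟩ := exists_convPow_propagate_sub_le hr hγ₀ hγ₁ R (p + 1)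
  obtain ⟨B', hB'⟩ := exists_convPow_propagate_sub_le hr hγ₀ hγ₁ R p
  refine ⟨K * (A' * B + A * B') + E * (A * B), fun s t a ha => ?_⟩
  have hm (b : (Fin d → ℤ) → ℂ) : seqNorm r b ≤ seqNorm (r + γ) b :=
    seqNorm_mono_exponent (by linarith) b
  set u := propagate t a with hu
  set w := propagate (-t) (conjCoeff a) with hw
  have hu' : seqNorm (r + γ) u ≤ R := by rwa [hu, seqNorm_propagate]
  have hw' : seqNorm (r + γ) w ≤ R := by rwa [hw, seqNorm_propagate, seqNorm_conjCoeff]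
  set X := convPow (propagate s u) (p + 1) with hX
  set X₀ := convPow u (p + 1) with hX₀
  set Y := convPow (propagate (-s) w) p with hY
  set Y₀ := convPow w p with hY₀
  set G := propagate (-2 * s) Y₀ with hG
  have bX : seqNorm (r + γ) X ≤ A := hA _ (by rwa [seqNorm_propagate])
  have bX₀ : seqNorm (r + γ) X₀ ≤ A := hA _ hu'
  have bY : seqNorm (r + γ) Y ≤ B := hB _ (by rwa [seqNorm_propagate])
  have bY₀ : seqNorm (r + γ) Y₀ ≤ B := hB _ hw'
  have bG : seqNorm (r + γ) G ≤ B := by rwa [hG, seqNorm_propagate]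
  have hnl : nonlin p (t + s) a = propagate (-t - s) (conv X Y) := by
    rw [nonlin, hX, hY, hu, hw, propagate_propagate, propagate_propagate, add_comm s t, neg_add,
      sub_eq_add_neg, add_comm (-s)]
  have hfr : propagate (-t) (conv X₀ G) = propagate (-t - s) (propagate s (conv X₀ G)) := by
    rw [propagate_propagate, sub_add_cancel]
  have hsG : propagate s G = propagate (-s) Y₀ := by
    rw [hG, propagate_propagate]; congr 1; ring
  rw [hnl, hfr, ← propagate_sub, seqNorm_propagate]
  have hsplit : (fun k => conv X Y k - propagate s (conv X₀ G) k) =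
      fun k => (conv X Y k - conv (propagate s X₀) (propagate (-s) Y₀) k) +
        (conv (propagate s X₀) (propagate s G) k - propagate s (conv X₀ G) k) := by
    funext k; rw [hsG]; ring
  rw [hsplit]
  refine (seqNorm_add_le _ _ _).trans ?_
  calc _ ≤ K * ((A' * ENNReal.ofReal (|s| ^ γ)) * B + A * (B' * ENNReal.ofReal (|s| ^ γ))) +
        E * ENNReal.ofReal (|s| ^ γ) * (A * B) := by
        refine add_le_add ((hK _ _ _ _ ?_ ?_ ?_ ?_).trans ?_) ((hE s _ _ ?_ ?_).trans ?_)
        · exact ne_top_of_le_coe ((hm _).trans bX)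
        · exact ne_top_of_le_coe ((hm _).trans ((seqNorm_propagate _ _ _).trans_le bX₀))
        · exact ne_top_of_le_coe ((hm _).trans bY)
        · exact ne_top_of_le_coe ((hm _).trans ((seqNorm_propagate _ _ _).trans_le bY₀))
        · gcongr
          · exact hA' s u hu'
          · exact (hm _).trans bY
          · exact (hm _).trans ((seqNorm_propagate _ _ _).trans_le bX₀)
          · simpa using hB' (-s) w hw'
        · exact ne_top_of_le_coe ((hm _).trans bX₀)
        · exact ne_top_of_le_coe ((hm _).trans bG)
        · gcongr
    _ = _ := by push_cast; ring

lemma hasDerivAt_mul_increment (hr : (d : ℝ) / 2 < r) (p : ℕ) (t s : ℝ) {a : (Fin d → ℤ) → ℂ}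
    (ha : seqNorm r a ≠ ∞) (k : Fin d → ℤ) :
    HasDerivAt (fun s : ℝ => (s : ℂ) * increment p s t a k)
      (propagate (-t) (conv (convPow (propagate t a) (p + 1))
        (propagate (-2 * s) (convPow (propagate (-t) (conjCoeff a)) p))) k) s := by
  have hpow (b : (Fin d → ℤ) → ℂ) (hb : seqNorm r b = seqNorm r a) (n : ℕ) :
      Summable fun k => ‖convPow b n k‖ := by
    obtain ⟨C, hC⟩ := exists_convPow_le hr (seqNorm r a).toNNReal n
    refine summable_norm_of_seqNorm hr (ne_top_of_le_coe (hC b ?_))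
    rw [ENNReal.coe_toNNReal ha, hb]
  have := (hasDerivAt_mul_conv_phiMul (hpow (propagate t a) (seqNorm_propagate _ _ _) (p + 1))
    (hpow (propagate (-t) (conjCoeff a)) (by rw [seqNorm_propagate, seqNorm_conjCoeff]) p)
    k s).const_mul (Complex.exp (Complex.I * (-t : ℝ) * ((-freqSq k : ℝ) : ℂ)))
  refine this.congr_of_eventuallyEq (Eventually.of_forall fun s => ?_)
  simp only [increment, propagate]
  ring

end NonlinearEstimates

instance isProbabilityMeasure_haar : IsProbabilityMeasure (haar d) := by
  unfold haar; infer_instance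

lemma continuous_character (k : Fin d → ℤ) : Continuous (character k) := by
  unfold character; fun_prop

lemma norm_character (k : Fin d → ℤ) (x : Torus d) : ‖character k x‖ = 1 := by
  rw [character, norm_prod]
  exact Finset.prod_eq_one fun j _ => Circle.norm_coe _

lemma character_add (k l : Fin d → ℤ) (x : Torus d) :
    character (k + l) x = character k x * character l x := by
  simp only [character, Pi.add_apply, fourier_add, Finset.prod_mul_distrib]

lemma character_neg (k : Fin d → ℤ) (x : Torus d) : character (-k) x = conj (character k x) := by
  simp only [character, Pi.neg_apply, fourier_neg, map_prod]

lemma character_zero (x : Torus d) : character 0 x = 1 := by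
  simp [character]

lemma integral_character (k : Fin d → ℤ) :
    ∫ x, character k x ∂(haar d) = if k = 0 then 1 else 0 := by
  have h1 (n : ℤ) : ∫ x : AddCircle (2 * π), fourier n x ∂AddCircle.haarAddCircle =
      if n = 0 then 1 else 0 := by
    have := congrFun (fourierCoeff_fourier (T := 2 * π) n) 0
    simpa [fourierCoeff, Pi.single_apply, eq_comm] using this
  have h2 : ∫ x, character k x ∂(haar d) =
      ∏ j, ∫ x : AddCircle (2 * π), fourier (k j) x ∂AddCircle.haarAddCircle :=
    integral_fintype_prod_eq_prod (𝕜 := ℂ) fun j (x : AddCircle (2 * π)) => fourier (k j) x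
  rw [h2]
  simp only [h1]
  split_ifs with h
  · simp [h]
  · obtain ⟨j, hj⟩ := Function.ne_iff.1 h
    exact Finset.prod_eq_zero (Finset.mem_univ j) (if_neg hj)

/-- The function with the given Fourier coefficients. -/
def synth (a : (Fin d → ℤ) → ℂ) : Torus d → ℂ := fun x => ∑' k, a k * character k x

lemma norm_mul_character (a : (Fin d → ℤ) → ℂ) (k : Fin d → ℤ) (x : Torus d) :
    ‖a k * character k x‖ = ‖a k‖ := by
  rw [norm_mul, norm_character, mul_one]

lemma continuous_synth {a : (Fin d → ℤ) → ℂ} (ha : Summable fun k => ‖a k‖) :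
    Continuous (synth a) :=
  continuous_tsum (fun k => continuous_const.mul (continuous_character k)) ha fun k x =>
    (norm_mul_character a k x).le

lemma memLp_of_continuous {f : Torus d → ℂ} (hf : Continuous f) (q : ℝ≥0∞) :
    MemLp f q (haar d) := by
  obtain ⟨C, hC⟩ := isCompact_univ.exists_bound_of_continuousOn hf.continuousOn
  exact MemLp.of_bound hf.aestronglyMeasurable C (Eventually.of_forall fun x => hC x (mem_univ x))

lemma integrable_conj_character_mul {f : Torus d → ℂ} (hf : Integrable f (haar d))
    (k : Fin d → ℤ) : Integrable (fun x => conj (character k x) * f x) (haar d) := by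
  refine hf.bdd_mul (c := 1)
    (Complex.continuous_conj.comp (continuous_character k)).aestronglyMeasurable ?_
  exact Eventually.of_forall fun x => by rw [RCLike.norm_conj, norm_character]

lemma coeff_sub {f g : Torus d → ℂ} (hf : Integrable f (haar d)) (hg : Integrable g (haar d)) :
    coeff (fun x => f x - g x) = fun k => coeff f k - coeff g k := by
  funext k
  simp only [coeff, mul_sub]
  exact integral_sub (integrable_conj_character_mul hf k) (integrable_conj_character_mul hg k)

lemma coeff_const_mul (c : ℂ) (f : Torus d → ℂ) :
    coeff (fun x => c * f x) = fun k => c * coeff f k := by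
  funext k
  simp only [coeff, mul_left_comm _ c]
  exact integral_const_mul _ _

lemma coeff_conj (f : Torus d → ℂ) : coeff (fun x => conj (f x)) = conjCoeff (coeff f) := by
  funext k
  simp only [coeff, conjCoeff]
  rw [← integral_conj]
  congr 1 with x
  rw [map_mul, character_neg, Complex.conj_conj]

lemma coeff_synth {a : (Fin d → ℤ) → ℂ} (ha : Summable fun k => ‖a k‖) : coeff (synth a) = a := by
  funext k
  have hint (l : Fin d → ℤ) :
      ∫ x, conj (character k x) * (a l * character l x) ∂(haar d) = if l = k then a k else 0 := by
    have : ∀ x, conj (character k x) * (a l * character l x) = a l * character (l - k) x := by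
      intro x
      rw [sub_eq_add_neg, character_add, character_neg]; ring
    simp only [this]
    rw [integral_const_mul, integral_character]
    simp only [sub_eq_zero]
    split_ifs with h <;> simp [h]
  have hnorm (l : Fin d → ℤ) (x : Torus d) :
      ‖conj (character k x) * (a l * character l x)‖ = ‖a l‖ := by
    rw [norm_mul, RCLike.norm_conj, norm_character, norm_mul_character, one_mul]
  have := hasSum_integral_of_summable_integral_norm (μ := haar d)
    (F := fun l x => conj (character k x) * (a l * character l x)) (fun l => ?_) ?_
  · simp only [hint] at this
    rw [coeff]
    simp only [synth, ← tsum_mul_left]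
    exact this.unique (hasSum_ite_eq k (a k))
  · refine (memLp_one_iff_integrable.1 (memLp_of_continuous ?_ 1))
    exact (Complex.continuous_conj.comp (continuous_character k)).mul
      (continuous_const.mul (continuous_character l))
  · simpa only [hnorm, integral_const, probReal_univ, one_smul] using ha

lemma synth_mul {a b : (Fin d → ℤ) → ℂ} (ha : Summable fun k => ‖a k‖)
    (hb : Summable fun k => ‖b k‖) (x : Torus d) :
    synth a x * synth b x = synth (conv a b) x := by
  have ha' : Summable fun k => ‖a k * character k x‖ := by simpa only [norm_mul_character]
  have hb' : Summable fun k => ‖b k * character k x‖ := by simpa only [norm_mul_character]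
  let e : (Fin d → ℤ) × (Fin d → ℤ) ≃ (Fin d → ℤ) × (Fin d → ℤ) :=
    { toFun := fun z => (z.1 - z.2, z.2)
      invFun := fun z => (z.1 + z.2, z.2)
      left_inv := fun z => by simp
      right_inv := fun z => by simp }
  have hs := (summable_mul_of_summable_norm ha' hb')
  rw [synth, synth, tsum_mul_tsum_of_summable_norm ha' hb', ← e.tsum_eq]
  refine (e.summable_iff.2 hs).tsum_prod.trans ?_
  simp only [synth, conv, ← tsum_mul_right]
  congr 1 with k
  congr 1 with l
  simp only [e, Function.comp_apply, Equiv.coe_fn_mk]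
  have : character k x = character (k - l) x * character l x := by
    rw [← character_add, sub_add_cancel]
  rw [this]; ring

lemma synth_single (x : Torus d) : synth (Pi.single 0 1) x = 1 := by
  rw [synth, tsum_eq_single 0]
  · simp [character_zero]
  · intro k hk; simp [hk]

lemma conj_synth (a : (Fin d → ℤ) → ℂ) (x : Torus d) :
    conj (synth a x) = synth (conjCoeff a) x := by
  rw [synth, Complex.conj_tsum, synth, ← (Equiv.neg (Fin d → ℤ)).tsum_eq]
  congr 1 with k
  simp [conjCoeff, character_neg]

section Dictionary

variable {r : ℝ}

lemma conv_ne_top (hr : (d : ℝ) / 2 < r) {a b : (Fin d → ℤ) → ℂ} (ha : seqNorm r a ≠ ∞)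
    (hb : seqNorm r b ≠ ∞) : seqNorm r (conv a b) ≠ ∞ := by
  obtain ⟨C, hC⟩ := exists_conv_le hr
  exact ((hC a b).trans_lt (ENNReal.mul_lt_top ENNReal.coe_lt_top
    (ENNReal.mul_lt_top ha.lt_top hb.lt_top))).ne

lemma convPow_ne_top (hr : (d : ℝ) / 2 < r) {a : (Fin d → ℤ) → ℂ} (ha : seqNorm r a ≠ ∞) (n : ℕ) :
    seqNorm r (convPow a n) ≠ ∞ := by
  induction n with
  | zero => exact seqNorm_single_ne_top r
  | succ n ih => exact conv_ne_top hr ih ha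

lemma propagate_ne_top {a : (Fin d → ℤ) → ℂ} (ha : seqNorm r a ≠ ∞) (t : ℝ) :
    seqNorm r (propagate t a) ≠ ∞ := by rwa [seqNorm_propagate]

lemma conjCoeff_ne_top {a : (Fin d → ℤ) → ℂ} (ha : seqNorm r a ≠ ∞) :
    seqNorm r (conjCoeff a) ≠ ∞ := by rwa [seqNorm_conjCoeff]

lemma phiMul_ne_top {a : (Fin d → ℤ) → ℂ} (ha : seqNorm r a ≠ ∞) (τ : ℝ) :
    seqNorm r (phiMul τ a) ≠ ∞ := ne_top_of_le_ne_top ha (seqNorm_phiMul_le r τ a)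

lemma coeff_synth_of_ne_top (hr : (d : ℝ) / 2 < r) {a : (Fin d → ℤ) → ℂ} (ha : seqNorm r a ≠ ∞) :
    coeff (synth a) = a :=
  coeff_synth (summable_norm_of_seqNorm hr ha)

lemma synth_mul_of_ne_top (hr : (d : ℝ) / 2 < r) {a b : (Fin d → ℤ) → ℂ} (ha : seqNorm r a ≠ ∞)
    (hb : seqNorm r b ≠ ∞) (x : Torus d) : synth a x * synth b x = synth (conv a b) x :=
  synth_mul (summable_norm_of_seqNorm hr ha) (summable_norm_of_seqNorm hr hb) x

lemma synth_pow (hr : (d : ℝ) / 2 < r) {a : (Fin d → ℤ) → ℂ} (ha : seqNorm r a ≠ ∞) (n : ℕ)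
    (x : Torus d) : synth a x ^ n = synth (convPow a n) x := by
  induction n with
  | zero => rw [pow_zero, convPow, synth_single]
  | succ n ih => rw [pow_succ, ih, synth_mul_of_ne_top hr (convPow_ne_top hr ha n) ha, convPow]

lemma schrodinger_eq (t : ℝ) (f : Torus d → ℂ) :
    schrodinger t f = synth (propagate t (coeff f)) := rfl

lemma funLaplacian_phi1_eq (τ : ℝ) (f : Torus d → ℂ) :
    funLaplacian phi1 (-2 * Complex.I * τ) f = synth (phiMul τ (coeff f)) := rfl

lemma nonlin_ne_top (hr : (d : ℝ) / 2 < r) (p : ℕ) (t : ℝ) {a : (Fin d → ℤ) → ℂ}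
    (ha : seqNorm r a ≠ ∞) : seqNorm r (nonlin p t a) ≠ ∞ :=
  propagate_ne_top (conv_ne_top hr (convPow_ne_top hr (propagate_ne_top ha _) _)
    (convPow_ne_top hr (propagate_ne_top (conjCoeff_ne_top ha) _) _)) _

lemma increment_ne_top (hr : (d : ℝ) / 2 < r) (p : ℕ) (τ t : ℝ) {a : (Fin d → ℤ) → ℂ}
    (ha : seqNorm r a ≠ ∞) : seqNorm r (increment p τ t a) ≠ ∞ :=
  propagate_ne_top (conv_ne_top hr (convPow_ne_top hr (propagate_ne_top ha _) _)
    (phiMul_ne_top (convPow_ne_top hr (propagate_ne_top (conjCoeff_ne_top ha) _) _) _)) _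

lemma twistedNonlinearity_eq (hr : (d : ℝ) / 2 < r) (p : ℕ) (t : ℝ) {w : Torus d → ℂ}
    (hw : seqNorm r (coeff w) ≠ ∞) :
    twistedNonlinearity p t w = synth (nonlin p t (coeff w)) := by
  have hu := propagate_ne_top hw t
  have h : (fun x => ((‖schrodinger t w x‖ ^ (2 * p) : ℝ) : ℂ) * schrodinger t w x) =
      synth (conv (convPow (propagate t (coeff w)) (p + 1))
        (convPow (propagate (-t) (conjCoeff (coeff w))) p)) := by
    funext x
    rw [← conjCoeff_propagate, ← synth_mul_of_ne_top hr (convPow_ne_top hr hu _)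
      (convPow_ne_top hr (conjCoeff_ne_top hu) _), ← synth_pow hr hu,
      ← synth_pow hr (conjCoeff_ne_top hu), ← conj_synth, ← schrodinger_eq, pow_mul]
    push_cast
    rw [← Complex.mul_conj', mul_pow]
    ring
  rw [twistedNonlinearity, h, schrodinger_eq, coeff_synth_of_ne_top hr]
  · rfl
  · exact conv_ne_top hr (convPow_ne_top hr hu _)
      (convPow_ne_top hr (propagate_ne_top (conjCoeff_ne_top hw) _) _)

lemma step_eq (hr : (d : ℝ) / 2 < r) (p : ℕ) (μ τ t : ℝ) {w : Torus d → ℂ}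
    (hw : seqNorm r (coeff w) ≠ ∞) :
    step p μ τ t w = fun x =>
      w x - Complex.I * μ * τ * synth (increment p τ t (coeff w)) x := by
  have hu := propagate_ne_top hw t
  have hu' := propagate_ne_top (conjCoeff_ne_top hw) (-t)
  have h1 : (fun z => schrodinger (-t) (fun z' => conj (w z')) z ^ p) =
      synth (convPow (propagate (-t) (conjCoeff (coeff w))) p) := by
    funext z
    rw [schrodinger_eq, coeff_conj, synth_pow hr hu']
  have h2 : (fun y => schrodinger t w y ^ (p + 1) *
      funLaplacian phi1 (-2 * Complex.I * τ)
        (fun z => schrodinger (-t) (fun z' => conj (w z')) z ^ p) y) =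
      synth (conv (convPow (propagate t (coeff w)) (p + 1))
        (phiMul τ (convPow (propagate (-t) (conjCoeff (coeff w))) p))) := by
    funext y
    rw [h1, funLaplacian_phi1_eq, coeff_synth_of_ne_top hr (convPow_ne_top hr hu' p),
      schrodinger_eq, synth_pow hr hu, synth_mul_of_ne_top hr (convPow_ne_top hr hu _)
      (phiMul_ne_top (convPow_ne_top hr hu' _) _)]
  funext x
  rw [step, h2, schrodinger_eq, coeff_synth_of_ne_top hr]
  · rfl
  · exact conv_ne_top hr (convPow_ne_top hr hu _) (phiMul_ne_top (convPow_ne_top hr hu' _) _)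

end Dictionary

section Convergence

variable {r γ : ℝ}

lemma IsSolution.hasDerivWithinAt_coeff (hr : (d : ℝ) / 2 < r) {p : ℕ} {μ T : ℝ}
    {v : ℝ → Torus d → ℂ} (hv : IsSolution p μ r T v) (k : Fin d → ℤ) {t : ℝ} (ht : t ∈ Icc 0 T) :
    HasDerivWithinAt (fun s => coeff (v s) k) (-Complex.I * μ * nonlin p t (coeff (v t)) k)
      (Icc 0 T) t := by
  have hr0 : 0 ≤ r := le_trans (by positivity) hr.le
  have hfin (s : ℝ) (hs : s ∈ Icc 0 T) : seqNorm r (coeff (v s)) ≠ ∞ := by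
    rw [← eSobolevNorm_eq]; exact (hv.mem s hs).2.ne
  have hint (s : ℝ) (hs : s ∈ Icc 0 T) : Integrable (v s) (haar d) :=
    (hv.mem s hs).1.integrable one_le_two
  have hN := nonlin_ne_top hr p t (hfin t ht)
  have hsynth : Integrable (synth (nonlin p t (coeff (v t)))) (haar d) :=
    memLp_one_iff_integrable.1
      (memLp_of_continuous (continuous_synth (summable_norm_of_seqNorm hr hN)) 1)
  rw [hasDerivWithinAt_iff_tendsto_slope, tendsto_iff_edist_tendsto_0]
  refine tendsto_of_tendsto_of_tendsto_of_le_of_le' tendsto_const_nhds (hv.deriv t ht)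
    (Eventually.of_forall fun _ => zero_le) ?_
  filter_upwards [self_mem_nhdsWithin] with s hs
  have hdiff : Integrable (fun x => ((s - t : ℝ) : ℂ)⁻¹ * (v s x - v t x)) (haar d) :=
    ((hint s hs.1).sub (hint t ht)).const_mul _
  rw [eSobolevNorm_eq, twistedNonlinearity_eq hr p t (hfin t ht),
    coeff_sub hdiff (hsynth.const_mul _),
    coeff_const_mul, coeff_const_mul, coeff_sub (hint s hs.1) (hint t ht),
    coeff_synth_of_ne_top hr hN, edist_eq_enorm_sub]
  refine le_trans (le_of_eq ?_) (enorm_le_seqNorm hr0 _ k)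
  simp only [slope, vsub_eq_sub, Complex.real_smul, Complex.ofReal_inv]

lemma enorm_I_mul_ofReal (x : ℝ) : ‖Complex.I * (x : ℂ)‖ₑ = ‖x‖₊ := by
  rw [enorm_eq_nnnorm, nnnorm_mul, Complex.nnnorm_I, one_mul, Complex.nnnorm_real]

/-- The local error of one step of the integrator. -/
lemma exists_local_error_le (hr : (d : ℝ) / 2 < r) (hγ₀ : 0 < γ) (hγ₁ : γ ≤ 1) (p : ℕ) (μ T : ℝ)
    (M : ℝ≥0) :
    ∃ C : ℝ≥0, ∀ a : ℝ → (Fin d → ℤ) → ℂ, (∀ t ∈ Icc 0 T, seqNorm (r + γ) (a t) ≤ M) →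
      (∀ k, ∀ t ∈ Icc 0 T, HasDerivWithinAt (fun s => a s k)
        (-Complex.I * μ * nonlin p t (a t) k) (Icc 0 T) t) →
      ∀ t τ : ℝ, 0 ≤ t → 0 ≤ τ → τ ≤ 1 → t + τ ≤ T →
        seqNorm r (fun k => a (t + τ) k -
            (a t k - Complex.I * μ * τ * increment p τ t (a t) k)) ≤
          C * ENNReal.ofReal (τ ^ γ) * ENNReal.ofReal τ := by
  obtain ⟨B, hB⟩ := exists_nonlin_le hr M p
  obtain ⟨L, hL⟩ := exists_nonlin_sub_le hr M p
  obtain ⟨F, hF⟩ := exists_nonlin_sub_frozen_le hr hγ₀ hγ₁ M p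
  refine ⟨‖μ‖₊ * (L * (‖μ‖₊ * B) + F), fun a ha hd t τ ht hτ hτ1 hT => ?_⟩
  have ha' (t : ℝ) (ht : t ∈ Icc 0 T) : seqNorm r (a t) ≤ M :=
    (seqNorm_mono_exponent (by linarith) _).trans (ha t ht)
  have hneg (c : ℂ) (b : (Fin d → ℤ) → ℂ) :
      seqNorm r (fun k => -Complex.I * μ * b k) = ‖μ‖₊ * seqNorm r b := by
    rw [seqNorm_const_mul, neg_mul, enorm_neg, enorm_I_mul_ofReal]
  have hincr (s : ℝ) (hs : s ∈ Icc 0 τ) :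
      seqNorm r (fun k => a (t + s) k - a t k) ≤ ‖μ‖₊ * B * ENNReal.ofReal s := by
    have hsub : Icc t (t + s) ⊆ Icc 0 T := Icc_subset_Icc ht (by linarith [hs.2])
    have := seqNorm_sub_le_of_hasDerivWithinAt (r := r) (h := a)
      (h' := fun s k => -Complex.I * μ * nonlin p s (a s) k) (α := t) (β := t + s)
      (by linarith [hs.1]) (R := ‖μ‖₊ * B) (fun k x hx => (hd k x (hsub hx)).mono hsub)
      (fun x hx => by
        rw [hneg 0]; push_cast; gcongr
        exact hB x _ (ha' x (hsub hx)))
    simpa using this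
  set D : ℝ → (Fin d → ℤ) → ℂ := fun s => propagate (-t) (conv (convPow (propagate t (a t)) (p + 1))
        (propagate (-2 * s) (convPow (propagate (-t) (conjCoeff (a t))) p))) with hD
  have ht' : t ∈ Icc 0 T := ⟨ht, by linarith⟩
  have key := seqNorm_sub_le_of_hasDerivWithinAt (r := r)
    (h := fun s k => a (t + s) k + Complex.I * μ * ((s : ℂ) * increment p s t (a t) k))
    (h' := fun s k => -Complex.I * μ * nonlin p (t + s) (a (t + s)) k + Complex.I * μ * D s k)
    hτ (R := ‖μ‖₊ * (L * (‖μ‖₊ * B) + F) * (τ ^ γ).toNNReal) ?_ ?_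
  · rw [sub_zero] at key
    refine le_trans (le_of_eq ?_) key
    congr 1 with k
    simp only [Complex.ofReal_zero, zero_mul, mul_zero, add_zero]
    ring
  · intro k s hs
    have hmem : t + s ∈ Icc 0 T := ⟨by linarith [hs.1], by linarith [hs.2]⟩
    have h1 : HasDerivWithinAt (fun s => a (t + s) k)
        (-Complex.I * μ * nonlin p (t + s) (a (t + s)) k) (Icc 0 τ) s := by
      have := (hd k (t + s) hmem).scomp s (((hasDerivAt_id s).const_add t).hasDerivWithinAt
        (s := Icc 0 τ)) (t' := Icc 0 T)
          (fun x hx => ⟨by change 0 ≤ t + x; linarith [hx.1],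
            by change t + x ≤ T; linarith [hx.2]⟩)
      rw [one_smul] at this
      exact this
    exact h1.add ((hasDerivAt_mul_increment hr p t s (ne_top_of_le_coe (ha' t ht'))
      k).const_mul (Complex.I * μ)).hasDerivWithinAt
  · intro s hs
    have hmem : t + s ∈ Icc 0 T := ⟨by linarith [hs.1], by linarith [hs.2]⟩
    have hsplit : (fun k => -Complex.I * μ * nonlin p (t + s) (a (t + s)) k +
        Complex.I * μ * D s k) = fun k => -Complex.I * μ *
          ((nonlin p (t + s) (a (t + s)) k - nonlin p (t + s) (a t) k) +
            (nonlin p (t + s) (a t) k - D s k)) := by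
      funext k; ring
    have hsτ : s ≤ τ ^ γ := by
      refine hs.2.trans ?_
      rcases hτ.eq_or_lt with h0 | h0
      · rw [← h0, Real.zero_rpow hγ₀.ne']
      · simpa using Real.rpow_le_rpow_of_exponent_ge h0 hτ1 hγ₁
    have hsγ : |s| ^ γ ≤ τ ^ γ := by
      rw [abs_of_nonneg hs.1]
      exact Real.rpow_le_rpow hs.1 hs.2 hγ₀.le
    simp only [hsplit]
    rw [hneg 0]
    calc _ ≤ ‖μ‖₊ * (L * (‖μ‖₊ * B * ENNReal.ofReal s) + F * ENNReal.ofReal (|s| ^ γ)) := by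
          gcongr
          refine (seqNorm_add_le _ _ _).trans (add_le_add ?_ (hF s t (a t) (ha t ht')))
          refine (hL _ _ _ (ha' _ hmem) (ha' _ ht')).trans ?_
          gcongr
          exact hincr s hs
      _ ≤ ‖μ‖₊ * (L * (‖μ‖₊ * B * ENNReal.ofReal (τ ^ γ)) + F * ENNReal.ofReal (τ ^ γ)) := by
          gcongr
      _ = _ := by rw [ENNReal.ofReal]; push_cast; ring

/-- One step of the discrete Gronwall argument. -/
lemma gronwall_step_le {K Λ τ δ x : ℝ} (hK : 0 ≤ K) (hΛ : 0 ≤ Λ) (hτ : 0 ≤ τ) (hδ : 0 ≤ δ)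
    (hx : 0 ≤ x) :
    K * δ * τ + (1 + Λ * τ) * (K * x * Real.exp (Λ * x) * δ) ≤
      K * (x + τ) * Real.exp (Λ * (x + τ)) * δ := by
  have h1 : 1 ≤ Real.exp (Λ * (x + τ)) := Real.one_le_exp (by positivity)
  have h2 : (1 + Λ * τ) * Real.exp (Λ * x) ≤ Real.exp (Λ * (x + τ)) := by
    rw [mul_add, add_comm (Λ * x), Real.exp_add]
    gcongr
    linarith [Real.add_one_le_exp (Λ * τ)]
  calc _ = K * δ * τ * 1 + K * x * δ * ((1 + Λ * τ) * Real.exp (Λ * x)) := by ring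
    _ ≤ K * δ * τ * Real.exp (Λ * (x + τ)) + K * x * δ * Real.exp (Λ * (x + τ)) := by gcongr
    _ = _ := by ring

lemma coeff_step (hr : (d : ℝ) / 2 < r) (p : ℕ) (μ τ t : ℝ) {w : Torus d → ℂ}
    (hw : MemLp w 2 (haar d)) (hw' : seqNorm r (coeff w) ≠ ∞) :
    MemLp (step p μ τ t w) 2 (haar d) ∧ coeff (step p μ τ t w) = fun k =>
      coeff w k - Complex.I * μ * τ * increment p τ t (coeff w) k := by
  have hI := increment_ne_top hr p τ t hw'
  have hc := continuous_synth (summable_norm_of_seqNorm hr hI)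
  have hm : MemLp (fun x => Complex.I * μ * τ * synth (increment p τ t (coeff w)) x) 2 (haar d) :=
    memLp_of_continuous (continuous_const.mul hc) 2
  rw [step_eq hr p μ τ t hw']
  refine ⟨hw.sub hm, ?_⟩
  rw [coeff_sub (hw.integrable one_le_two) (hm.integrable one_le_two), coeff_const_mul,
    coeff_synth_of_ne_top hr hI]

lemma exists_scheme_error_le (hr : (d : ℝ) / 2 < r) (hγ₀ : 0 < γ) (hγ₁ : γ ≤ 1) (p : ℕ) (μ T : ℝ)
    (M : ℝ≥0) :
    ∃ τ₀ : ℝ, 0 < τ₀ ∧ ∃ c : ℝ, 0 < c ∧ ∀ v : ℝ → Torus d → ℂ, IsSolution p μ r T v →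
      (∀ t ∈ Icc 0 T, seqNorm (r + γ) (coeff (v t)) ≤ M) →
      ∀ τ : ℝ, 0 < τ → τ ≤ τ₀ → ∀ n : ℕ, n * τ ≤ T →
        MemLp (scheme p μ τ (v 0) n) 2 (haar d) ∧
        seqNorm r (coeff (scheme p μ τ (v 0) n)) ≤ (M + 1 : ℝ≥0) ∧
        seqNorm r (fun k => coeff (v (n * τ)) k - coeff (scheme p μ τ (v 0) n) k) ≤
          ENNReal.ofReal (c * τ ^ γ) := by
  obtain ⟨K, hK⟩ := exists_local_error_le hr hγ₀ hγ₁ p μ T M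
  obtain ⟨Λ₀, hΛ₀⟩ := exists_increment_sub_le hr (M + 1) p
  set Λ : ℝ≥0 := ‖μ‖₊ * Λ₀ with hΛ
  set c : ℝ := K * |T| * Real.exp (Λ * |T|) + 1 with hc
  have hc1 : 1 ≤ c := by
    have : 0 ≤ K * |T| * Real.exp (Λ * |T|) := by positivity
    linarith
  have hc0 : 0 < c := by linarith
  refine ⟨(c⁻¹) ^ (γ⁻¹), by positivity, c, hc0, fun v hv hM τ hτ hτ₀ => ?_⟩
  have hτγ : c * τ ^ γ ≤ 1 := by
    have : τ ^ γ ≤ c⁻¹ := by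
      calc τ ^ γ ≤ ((c⁻¹) ^ (γ⁻¹)) ^ γ := Real.rpow_le_rpow hτ.le hτ₀ hγ₀.le
        _ = c⁻¹ := Real.rpow_inv_rpow (by positivity) hγ₀.ne'
    calc c * τ ^ γ ≤ c * c⁻¹ := by gcongr
      _ = 1 := mul_inv_cancel₀ hc0.ne'
  have hτ1 : τ ≤ 1 := hτ₀.trans
    (Real.rpow_le_one (by positivity) (inv_le_one_of_one_le₀ hc1) (by positivity))
  have hτγ0 : 0 ≤ τ ^ γ := Real.rpow_nonneg hτ.le γ
  have hbound (n : ℕ) (hn : n * τ ≤ T) :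
      K * (n * τ) * Real.exp (Λ * (n * τ)) * τ ^ γ ≤ c * τ ^ γ := by
    have hn' : n * τ ≤ |T| := hn.trans (le_abs_self T)
    have : K * (n * τ) * Real.exp (Λ * (n * τ)) ≤ K * |T| * Real.exp (Λ * |T|) := by gcongr
    gcongr
    linarith
  have hmem (n : ℕ) (hn : n * τ ≤ T) : n * τ ∈ Icc 0 T := ⟨by positivity, hn⟩
  have hM' (t : ℝ) (ht : t ∈ Icc 0 T) : seqNorm r (coeff (v t)) ≤ M :=
    (seqNorm_mono_exponent (by linarith) _).trans (hM t ht)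
  have hball (n : ℕ) (hn : n * τ ≤ T) (w : Torus d → ℂ)
      (hw : seqNorm r (fun k => coeff (v (n * τ)) k - coeff w k) ≤
        ENNReal.ofReal (K * (n * τ) * Real.exp (Λ * (n * τ)) * τ ^ γ)) :
      seqNorm r (coeff w) ≤ (M + 1 : ℝ≥0) := by
    have h1 : coeff w = fun k => coeff (v (n * τ)) k -
        (coeff (v (n * τ)) k - coeff w k) := by funext k; ring
    rw [h1]
    refine (seqNorm_sub_le _ _ _).trans ?_
    push_cast
    gcongr
    · exact hM' _ (hmem n hn)
    · refine hw.trans ?_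
      rw [ENNReal.ofReal_le_one]
      exact (hbound n hn).trans hτγ
  have main (n : ℕ) (hn : n * τ ≤ T) : MemLp (scheme p μ τ (v 0) n) 2 (haar d) ∧
      seqNorm r (fun k => coeff (v (n * τ)) k - coeff (scheme p μ τ (v 0) n) k) ≤
        ENNReal.ofReal (K * (n * τ) * Real.exp (Λ * (n * τ)) * τ ^ γ) := by
    induction n with
    | zero =>
      have h0 : (0 : ℝ) ∈ Icc 0 T := by simpa using hmem 0 hn
      refine ⟨(hv.mem 0 h0).1, ?_⟩
      simp [scheme, seqNorm_zero]
    | succ n ih =>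
      have hstep : ((n + 1 : ℕ) : ℝ) * τ = n * τ + τ := by push_cast; ring
      rw [hstep] at hn ⊢
      have hn' : n * τ ≤ T := by linarith
      obtain ⟨ih1, ih2⟩ := ih hn'
      have hb := hball n hn' _ ih2
      obtain ⟨h1, h2⟩ := coeff_step hr p μ τ (n * τ) ih1 (ne_top_of_le_coe hb)
      refine ⟨h1, ?_⟩
      rw [scheme, h2]
      set a := coeff (v (n * τ)) with ha
      set b := coeff (scheme p μ τ (v 0) n) with hb'
      have hlocal := hK (fun t => coeff (v t)) hM
        (fun k t ht => hv.hasDerivWithinAt_coeff hr k ht) (n * τ) τ (by positivity) hτ.le hτ1 hn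
      have hstab : seqNorm r (fun k => (a k - b k) - Complex.I * μ * τ *
          (increment p τ (n * τ) a k - increment p τ (n * τ) b k)) ≤
          (1 + Λ * ENNReal.ofReal τ) * seqNorm r (fun k => a k - b k) := by
        refine (seqNorm_sub_le _ _ _).trans ?_
        rw [seqNorm_const_mul, enorm_mul, enorm_I_mul_ofReal, ← ofReal_norm (τ : ℂ),
          Complex.norm_real, Real.norm_of_nonneg hτ.le, add_mul, one_mul]
        refine add_le_add le_rfl ?_
        calc _ ≤ ‖μ‖₊ * ENNReal.ofReal τ * (Λ₀ * seqNorm r fun k => a k - b k) := by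
              gcongr
              refine hΛ₀ τ (n * τ) a b ((hM' _ (hmem n hn')).trans ?_) hb
              push_cast
              exact le_self_add
          _ = _ := by rw [hΛ]; push_cast; ring
      have hsplit : (fun k => coeff (v (n * τ + τ)) k -
          (b k - Complex.I * μ * τ * increment p τ (n * τ) b k)) =
          fun k => (coeff (v (n * τ + τ)) k -
            (a k - Complex.I * μ * τ * increment p τ (n * τ) a k)) +
            ((a k - b k) - Complex.I * μ * τ *
              (increment p τ (n * τ) a k - increment p τ (n * τ) b k)) := by
        funext k; ring
      rw [hsplit]
      refine (seqNorm_add_le _ _ _).trans ((add_le_add hlocal (hstab.trans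
        (mul_le_mul_right ih2 _))).trans ?_)
      refine le_trans (le_of_eq ?_) (ENNReal.ofReal_le_ofReal
        (gronwall_step_le K.coe_nonneg Λ.coe_nonneg hτ.le hτγ0 (by positivity : 0 ≤ n * τ)))
      have hΛτ : ENNReal.ofReal (1 + Λ * τ) = 1 + Λ * ENNReal.ofReal τ := by
        rw [ENNReal.ofReal_add zero_le_one (by positivity), ENNReal.ofReal_mul Λ.coe_nonneg,
          ENNReal.ofReal_one, ENNReal.ofReal_coe_nnreal]
      rw [ENNReal.ofReal_add (by positivity) (by positivity),
        ENNReal.ofReal_mul (p := 1 + Λ * τ) (by positivity), hΛτ,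
        ENNReal.ofReal_mul (p := K * τ ^ γ) (by positivity), ENNReal.ofReal_mul K.coe_nonneg,
        ENNReal.ofReal_coe_nnreal]
  intro n hn
  obtain ⟨h1, h2⟩ := main n hn
  exact ⟨h1, hball n hn _ h2, h2.trans (ENNReal.ofReal_le_ofReal (hbound n hn))⟩

end Convergence

end TwistedNLS

end

theorem theorem1 (d p : ℕ) (μ r γ T : ℝ) (hr : (d : ℝ) / 2 < r) (hγ₀ : 0 < γ) (hγ₁ : γ ≤ 1)
    (M : ℝ≥0) :
    ∃ τ₀ : ℝ, 0 < τ₀ ∧ ∃ c : ℝ, 0 < c ∧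
      ∀ v : ℝ → TwistedNLS.Torus d → ℂ,
        TwistedNLS.IsSolution p μ r T v →
        (∀ t ∈ Set.Icc 0 T, TwistedNLS.MemSobolev (r + γ) (v t)) →
        (⨆ t ∈ Set.Icc 0 T, TwistedNLS.eSobolevNorm (r + γ) (v t)) ≤ M →
        ∀ τ : ℝ, 0 < τ → τ ≤ τ₀ → ∀ n : ℕ, n * τ ≤ T →
          TwistedNLS.MemSobolev r (TwistedNLS.scheme p μ τ (v 0) n) ∧
          TwistedNLS.eSobolevNorm r
              (fun x => v (n * τ) x - TwistedNLS.scheme p μ τ (v 0) n x) ≤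
            ENNReal.ofReal (c * τ ^ γ) := by
  obtain ⟨τ₀, hτ₀, c, hc, h⟩ := TwistedNLS.exists_scheme_error_le hr hγ₀ hγ₁ p μ T M
  refine ⟨τ₀, hτ₀, c, hc, fun v hv _ hM τ hτ hττ₀ n hn => ?_⟩
  have hM' (t : ℝ) (ht : t ∈ Set.Icc 0 T) :
      TwistedNLS.seqNorm (r + γ) (TwistedNLS.coeff (v t)) ≤ M := by
    rw [← TwistedNLS.eSobolevNorm_eq]
    exact (le_iSup₂ (f := fun t (_ : t ∈ Set.Icc 0 T) =>
      TwistedNLS.eSobolevNorm (r + γ) (v t)) t ht).trans hM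
  obtain ⟨h1, h2, h3⟩ := h v hv hM' τ hτ hττ₀ n hn
  have ht : n * τ ∈ Set.Icc 0 T := ⟨by positivity, hn⟩
  refine ⟨⟨h1, ?_⟩, ?_⟩
  · rw [TwistedNLS.eSobolevNorm_eq]
    exact h2.trans_lt ENNReal.coe_lt_top
  · rw [TwistedNLS.eSobolevNorm_eq, TwistedNLS.coeff_sub
      ((hv.mem _ ht).1.integrable one_le_two) (h1.integrable one_le_two)]
    exact h3
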